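/- A partition matroid on a finite ground set $E$ is given by a partition of $E$ into disjoint parts $A_1,\dots,A_m$ and integers $0\le b_i\le |A_i|$; a set $S\subseteq E$ is independent iff $|S\cap A_i|\le b_i$ for all $i$. The parts and the budgets $b_i$ are unknown to the algorithm, which has access to the matroid only through an independence oracle: a query is a subset $S\subseteq E$, and the answer tells whether $S$ is independent. In one adaptive round a deterministic algorithm submits a finite set of queries simultaneously; this set may depend only on $n=|E|$ and on the answers obtained in earlier rounds. The algorithm may be non-uniform in $n$, and only rounds and queries are counted. **Theorem.** There is a deterministic algorithm that finds a basis of any $n$-element partition matroid in $\tilde O(n^{1/3})$ adaptive rounds, using only polynomially many independence queries in each round and in total. That is, there are deterministic algorithms $(\mathcal A_n)_{n\ge 0}$ and constants $C\in\mathbb R$, $c,d\in\mathbb N$ such that for every $n$ and every partition matroid $\mathcal M$ on $E=\{1,\dots,n\}$, the algorithm $\mathcal A_n$, run with the independence oracle of $\mathcal M$, outputs a basis of $\mathcal M$ after at most $C\,n^{1/3}(\log(n+2))^{c}$ adaptive rounds, makes at most $C\,n^{d}$ queries in each round, and at most $C\,n^{d}$ queries in total. -/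

import Mathlib

/-- A deterministic adaptive algorithm on the ground set `E` with access to a membership oracle for
a family of subsets of `E`. The algorithm either stops and outputs a set, or performs one more
adaptive round: it submits a finite set `Q` of queries at once, and continues according to the
answers to the queries in `Q`. Local computation is free; only rounds and queries are counted. -/
inductive QueryAlgorithm (E : Type*) where
  | output (B : Finset E) : QueryAlgorithm E
  | round (Q : Finset (Finset E)) (next : ({S // S ∈ Q} → Bool) → QueryAlgorithm E) :
      QueryAlgorithm E

namespace QueryAlgorithm

variable {E : Type*}

/-- The set returned by the algorithm when its queries are answered by `oracle`. -/
def result (oracle : Finset E → Bool) : QueryAlgorithm E → Finset E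
  | output B => B
  | round _ next => result oracle (next fun S => oracle S.1)

/-- The list of the numbers of queries made in the successive rounds of the run of the algorithm
in which its queries are answered by `oracle`. -/
def queryCounts (oracle : Finset E → Bool) : QueryAlgorithm E → List ℕ
  | output _ => []
  | round Q next => Q.card :: queryCounts oracle (next fun S => oracle S.1)

/-- The number of adaptive rounds of the run in which queries are answered by `oracle`. -/
def numRounds (oracle : Finset E → Bool) (alg : QueryAlgorithm E) : ℕ :=
  (alg.queryCounts oracle).length

/-- The total number of queries of the run in which queries are answered by `oracle`. -/
def numQueries (oracle : Finset E → Bool) (alg : QueryAlgorithm E) : ℕ :=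
  (alg.queryCounts oracle).sum

end QueryAlgorithm

open Classical in
/-- The independence oracle of a matroid: it tells whether a finite set is independent. -/
noncomputable def Matroid.indepOracle {E : Type*} (M : Matroid E) (S : Finset E) : Bool :=
  decide (M.Indep (S : Set E))

/-- `M` is a partition matroid whose ground set is the whole finite type `E`: there are a partition
of `E` into disjoint parts `A 0, …, A (m - 1)` and budgets `b i` with `0 ≤ b i ≤ |A i|` such that a
set is independent iff it has at most `b i` elements in `A i` for every `i`. -/
def Matroid.IsPartitionMatroid {E : Type*} [Fintype E] [DecidableEq E] (M : Matroid E) : Prop :=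
  M.E = Set.univ ∧
  ∃ (m : ℕ) (A : Fin m → Finset E) (b : Fin m → ℕ),
    (∀ i j, i ≠ j → Disjoint (A i) (A j)) ∧
    (∀ x, ∃ i, x ∈ A i) ∧
    (∀ i, b i ≤ (A i).card) ∧
    ∀ S : Finset E, M.Indep (S : Set E) ↔ ∀ i, (S ∩ A i).card ≤ b i

/-! ### Random subsets at rate `p`, and comparison of different rates. -/

section Sampling

open Finset

variable {α : Type*}

/-! Regard the parts as colours. If a set exceeds exactly one budget, by exactly one, then single
deletions reveal its elements of that colour, which form a circuit, and exchanges with this circuit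
reveal the whole colour class. So two rounds settle every colour isolated by some query set. The
query sets come from one fixed family per `n`, obtained by a greedy hitting argument over all
colourings and budgets (`exists_isolating_family`). It isolates every active colour that is exceeded
with probability at least `1 / (12 n²)` at some sampling rate at which the excess probabilities of
the active colours sum to at most `1 / 2`. The rates occur only in the analysis.

To count steps, raise the rate from `τ` to the rate `q` at which this sum equals `1 / 2`. Some
active colour `i` is then exceeded with probability at least `1 / (2n)`, though at `τ` the
probability was below `1 / (12 n²)`, as all likelier colours had been settled. By Cauchy-Schwarz
(`sampleProb_sq_le`) such a jump requires `q - τ` to be more than one standard deviation of the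
relative size of a sample of the class of `i`. If this class has at most `s` elements,
`ratePotential` grows by at least one, and its range is `O(√s + log n)`. Otherwise a class larger
than `s` is settled, which happens at most `n / s` times. The choice `s = n^(2/3)` gives `O(n^(1/3)
+ log n)` steps (`card_le_of_mem_of_steps`). At the end all remaining elements together fit their
budgets and are added to the output. -/

/-- The probability that the random subset `S` of `A` containing each element of `A` independently
with probability `p` satisfies `G`. -/
noncomputable def sampleProb (p : ℝ) (A : Finset α) (G : Finset α → Prop) : ℝ :=
  open Classical in ∑ S ∈ A.powerset with G S, p ^ #S * (1 - p) ^ (#A - #S)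

theorem sampleWeight_nonneg {p : ℝ} (hp : 0 ≤ p) (hp' : p ≤ 1) (A S : Finset α) :
    0 ≤ p ^ #S * (1 - p) ^ (#A - #S) :=
  mul_nonneg (pow_nonneg hp _) (pow_nonneg (sub_nonneg.2 hp') _)

theorem sampleProb_nonneg {p : ℝ} (hp : 0 ≤ p) (hp' : p ≤ 1) (A : Finset α)
    (G : Finset α → Prop) : 0 ≤ sampleProb p A G :=
  sum_nonneg fun S _ => sampleWeight_nonneg hp hp' A S

theorem sampleProb_mono {p : ℝ} (hp : 0 ≤ p) (hp' : p ≤ 1) (A : Finset α)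
    {G H : Finset α → Prop} (h : ∀ S ⊆ A, G S → H S) : sampleProb p A G ≤ sampleProb p A H := by
  classical
  refine sum_le_sum_of_subset_of_nonneg (fun S hS => ?_) fun S _ _ =>
    sampleWeight_nonneg hp hp' A S
  simp only [mem_filter, mem_powerset] at hS ⊢
  exact ⟨hS.1, h S hS.1 hS.2⟩

theorem sampleProb_congr (p : ℝ) (A : Finset α) {G H : Finset α → Prop}
    (h : ∀ S ⊆ A, (G S ↔ H S)) : sampleProb p A G = sampleProb p A H := by
  classical
  unfold sampleProb
  congr 1
  refine filter_congr fun S hS => h S (mem_powerset.1 hS)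

theorem sampleProb_eq_zero (p : ℝ) {A : Finset α} {G : Finset α → Prop} (h : ∀ S ⊆ A, ¬ G S) :
    sampleProb p A G = 0 := by
  classical
  refine sum_eq_zero fun S hS => ?_
  obtain ⟨hSA, hGS⟩ := mem_filter.1 hS
  exact absurd hGS (h S (mem_powerset.1 hSA))

theorem sampleProb_true (p : ℝ) (A : Finset α) : sampleProb p A (fun _ => True) = 1 := by
  simp [sampleProb, Finset.sum_pow_mul_eq_add_pow]

theorem sampleProb_not_add (p : ℝ) (A : Finset α) (G : Finset α → Prop) :
    sampleProb p A G + sampleProb p A (fun S => ¬ G S) = 1 := by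
  classical
  rw [← sampleProb_true p A]
  unfold sampleProb
  rw [sum_filter_add_sum_filter_not]
  simp

theorem sampleProb_exists_le {ι : Type*} {p : ℝ} (hp : 0 ≤ p) (hp' : p ≤ 1) (A : Finset α)
    (J : Finset ι) (G : ι → Finset α → Prop) :
    sampleProb p A (fun S => ∃ j ∈ J, G j S) ≤ ∑ j ∈ J, sampleProb p A (G j) := by
  classical
  unfold sampleProb
  simp only [sum_filter]
  rw [sum_comm]
  refine sum_le_sum fun S _ => ?_
  have hw := sampleWeight_nonneg hp hp' A S
  split_ifs with h
  · obtain ⟨j, hj, hG⟩ := h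
    refine le_trans (by rw [if_pos hG]) (single_le_sum (fun i _ => ?_) hj)
    split_ifs <;> simp [hw]
  · exact sum_nonneg fun i _ => by split_ifs <;> simp [hw]

theorem sampleProb_continuous (A : Finset α) (G : Finset α → Prop) :
    Continuous fun p => sampleProb p A G := by
  unfold sampleProb
  fun_prop

theorem sampleProb_one (A : Finset α) {G : Finset α → Prop} (h : G A) :
    sampleProb 1 A G = 1 := by
  classical
  unfold sampleProb
  rw [sum_eq_single_of_mem A (by simp [h])]
  · simp
  · intro S hS hne
    have hS' := mem_powerset.1 (mem_filter.1 hS).1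
    have : #A - #S ≠ 0 := by
      have := card_lt_card (hS'.ssubset_of_ne hne)
      omega
    simp [this]

/-- Disjoint parts of the ground set are sampled independently. -/
theorem sampleProb_union [DecidableEq α] (p : ℝ) {A A' : Finset α} (h : Disjoint A A')
    (G H : Finset α → Prop) :
    sampleProb p (A ∪ A') (fun S => G (S ∩ A) ∧ H (S ∩ A')) =
      sampleProb p A G * sampleProb p A' H := by
  classical
  unfold sampleProb
  rw [sum_mul_sum, ← sum_product']
  symm
  refine sum_nbij' (fun X => X.1 ∪ X.2) (fun S => (S ∩ A, S ∩ A')) ?_ ?_ ?_ ?_ ?_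
  all_goals simp only [mem_product, mem_filter, mem_powerset]
  · rintro ⟨X, Y⟩ ⟨⟨hX, hG⟩, hY, hH⟩
    have e1 : (X ∪ Y) ∩ A = X := by
      rw [union_inter_distrib_right, inter_eq_left.2 hX,
        disjoint_iff_inter_eq_empty.1 (h.symm.mono_left hY), union_empty]
    have e2 : (X ∪ Y) ∩ A' = Y := by
      rw [union_inter_distrib_right, inter_eq_left.2 hY,
        disjoint_iff_inter_eq_empty.1 (h.mono_left hX), empty_union]
    simp only [e1, e2]
    exact ⟨union_subset_union hX hY, hG, hH⟩
  · rintro S ⟨hS, hG, hH⟩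
    exact ⟨⟨inter_subset_right, hG⟩, inter_subset_right, hH⟩
  · rintro ⟨X, Y⟩ ⟨⟨hX, hG⟩, hY, hH⟩
    ext1
    · simp [union_inter_distrib_right, inter_eq_left.2 hX,
        disjoint_iff_inter_eq_empty.1 (h.symm.mono_left hY)]
    · simp [union_inter_distrib_right, inter_eq_left.2 hY,
        disjoint_iff_inter_eq_empty.1 (h.mono_left hX)]
  · rintro S ⟨hS, hG, hH⟩
    simp [← inter_union_distrib_left, inter_eq_left.2 hS]
  · rintro ⟨X, Y⟩ ⟨⟨hX, hG⟩, hY, hH⟩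
    have hd : Disjoint X Y := h.mono hX hY
    have h1 : #X ≤ #A := card_le_card hX
    have h2 : #Y ≤ #A' := card_le_card hY
    simp only [card_union_of_disjoint hd, card_union_of_disjoint h]
    rw [show #A + #A' - (#X + #Y) = (#A - #X) + (#A' - #Y) by omega, pow_add, pow_add]
    ring

theorem sampleProb_inter [DecidableEq α] (p : ℝ) {A U : Finset α} (h : A ⊆ U)
    (G : Finset α → Prop) :
    sampleProb p U (fun S => G (S ∩ A)) = sampleProb p A G := by
  have := sampleProb_union p (disjoint_sdiff (s := A) (t := U)) G fun _ => True
  rw [sampleProb_true, mul_one, union_sdiff_of_subset h] at this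
  simpa using this

theorem sampleProb_nonempty_le {p : ℝ} (hp : 0 ≤ p) (hp' : p ≤ 1) (A : Finset α) :
    sampleProb p A (fun S => S.Nonempty) ≤ #A * p := by
  classical
  have h0 : (1 - p) ^ #A ≤ sampleProb p A (fun S => ¬ S.Nonempty) := by
    unfold sampleProb
    refine le_trans ?_ (single_le_sum (fun S _ => sampleWeight_nonneg hp hp' A S)
      (a := ∅) (by simp))
    simp
  have h1 := one_add_mul_le_pow (a := -p) (by linarith) #A
  have h2 := sampleProb_not_add p A fun S => S.Nonempty
  rw [← sub_eq_add_neg] at h1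
  linarith

/-- Comparison of two sampling rates, by the Cauchy-Schwarz inequality. -/
theorem sampleProb_sq_le {p : ℝ} (hp : 0 < p) (hp' : p < 1) (q : ℝ)
    (A : Finset α) (G : Finset α → Prop) :
    sampleProb q A G ^ 2 ≤
      sampleProb p A G * (1 + (q - p) ^ 2 / (p * (1 - p))) ^ #A := by
  classical
  have hp1 : 0 < 1 - p := by linarith
  -- The right side is the second moment, per element, of the likelihood ratio of rate `q` to rate
  -- `p`; by independence the moments multiply over `A`.
  have key : (1 + (q - p) ^ 2 / (p * (1 - p))) = q ^ 2 / p + (1 - q) ^ 2 / (1 - p) := by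
    field_simp
    ring
  rw [key, ← Finset.sum_pow_mul_eq_add_pow]
  refine (sum_sq_le_sum_mul_sum_of_sq_le_mul _ (g := fun S =>
    (q ^ 2 / p) ^ #S * ((1 - q) ^ 2 / (1 - p)) ^ (#A - #S))
    (f := fun S => p ^ #S * (1 - p) ^ (#A - #S)) ?_ ?_ ?_).trans ?_
  · intro S _
    positivity
  · intro S _
    positivity
  · intro S _
    refine le_of_eq ?_
    have hp0 := hp1.ne'
    generalize 1 - p = r at hp0
    generalize 1 - q = t
    rw [div_pow, div_pow]
    field_simp
    ring
  · refine mul_le_mul_of_nonneg_left ?_ (sampleProb_nonneg hp.le hp'.le A G)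
    exact sum_le_sum_of_subset_of_nonneg (filter_subset _ _) fun S _ _ => by positivity

/-- When the rates differ by at most one standard deviation of the relative sample size, the
Cauchy-Schwarz factor is at most `e < 3`. -/
theorem sq_div_three_le_sampleProb {p : ℝ} (hp : 0 < p) (hp' : p < 1) (q : ℝ)
    (A : Finset α) (G : Finset α → Prop)
    (h : #A * (q - p) ^ 2 ≤ p * (1 - p)) :
    sampleProb q A G ^ 2 / 3 ≤ sampleProb p A G := by
  have hp1 : 0 < 1 - p := by linarith
  set x := (q - p) ^ 2 / (p * (1 - p)) with hx
  have h1 : #A * x ≤ 1 := by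
    rw [hx, ← mul_div_assoc, div_le_one (by positivity)]
    exact h
  have hx0 : 0 ≤ x := by positivity
  have h2 : (1 + x) ^ #A ≤ 3 := by
    calc (1 + x) ^ #A ≤ Real.exp x ^ #A := by
          gcongr
          linarith [Real.add_one_le_exp x]
      _ = Real.exp (#A * x) := by rw [← Real.exp_nat_mul]
      _ ≤ Real.exp 1 := Real.exp_le_exp.2 h1
      _ ≤ 3 := by linarith [Real.exp_one_lt_d9]
  have h3 := sampleProb_sq_le hp hp' q A G
  have h4 := mul_le_mul_of_nonneg_left h2 (sampleProb_nonneg hp.le hp'.le A G)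
  linarith

/-- The weights of the mixture of all sampling rates: first a size, then a set of that size is
chosen uniformly. -/
noncomputable def mixedWeight [Fintype α] (S : Finset α) : ℝ :=
  1 / ((Fintype.card α + 1) * (Fintype.card α).choose #S)

theorem mixedWeight_nonneg [Fintype α] (S : Finset α) : 0 ≤ mixedWeight S := by
  unfold mixedWeight
  positivity

theorem sum_mixedWeight [Fintype α] : ∑ S : Finset α, mixedWeight S = 1 := by
  classical
  have : ∑ S : Finset α, mixedWeight S =
      ∑ S ∈ (univ : Finset α).powerset,
        (fun k => 1 / ((Fintype.card α + 1) * (Fintype.card α).choose k : ℝ)) #S := by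
    simp [mixedWeight]
  rw [this, sum_powerset_apply_card (fun k =>
    1 / ((Fintype.card α + 1) * (Fintype.card α).choose k : ℝ)), card_univ]
  have h : ∀ m ∈ range (Fintype.card α + 1), (Fintype.card α).choose m •
      (1 / ((Fintype.card α + 1) * (Fintype.card α).choose m : ℝ)) =
        1 / (Fintype.card α + 1) := by
    intro m hm
    have : 0 < (Fintype.card α).choose m :=
      Nat.choose_pos (Nat.lt_succ_iff.1 (mem_range.1 hm))
    rw [nsmul_eq_mul]
    field_simp
  rw [sum_congr rfl h]
  simp
  field_simp

/-- Given its size, a sample is uniform, and the mixture gives each size the weight `1 / (n + 1)`.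
So one distribution dominates every rate up to a factor `n + 1`, and the query family need not know
the rate. -/
theorem sampleProb_le_mixedWeight [Fintype α] [DecidableEq α] {p : ℝ} (hp : 0 ≤ p) (hp' : p ≤ 1)
    (G : Finset α → Prop) [DecidablePred G] :
    sampleProb p univ G ≤ (Fintype.card α + 1) * ∑ S with G S, mixedWeight S := by
  unfold sampleProb
  rw [mul_sum, powerset_univ]
  have : (univ.filter fun S => G S) = @filter _ G (fun a => Classical.propDecidable _) univ := by
    congr
  rw [← this]
  refine sum_le_sum fun S _ => ?_
  have hc : 0 < (Fintype.card α).choose #S := Nat.choose_pos (card_le_univ S)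
  have h1 : (Fintype.card α + 1) * mixedWeight S = 1 / (Fintype.card α).choose #S := by
    unfold mixedWeight
    field_simp
  rw [h1, le_div_iff₀ (by exact_mod_cast hc), card_univ]
  have h2 := add_pow p (1 - p) (Fintype.card α)
  have h3 := single_le_sum (f := fun m => p ^ m * (1 - p) ^ (Fintype.card α - m) *
    ((Fintype.card α).choose m : ℝ)) (s := range (Fintype.card α + 1)) (a := #S)
    (fun i _ => mul_nonneg (mul_nonneg (pow_nonneg hp _) (pow_nonneg (sub_nonneg.2 hp') _))
      (Nat.cast_nonneg _)) (mem_range.2 (Nat.lt_succ_iff.2 (card_le_univ S)))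
  rw [← h2] at h3
  simpa using h3

end Sampling

/-! ### Isolating families by greedy hitting sets. -/

section Isolation

open Finset

/-- Greedy hitting sets: if each of finitely many events has probability at least `η`, then some
`N` outcomes miss at most a `(1 - η) ^ N` fraction of the events. -/
theorem exists_finset_card_unhit_le {Ω T : Type*} [Fintype Ω] (w : Ω → ℝ)
    (hw : ∀ ω, 0 ≤ w ω) (hw1 : ∑ ω, w ω = 1) (H : T → Ω → Prop) [∀ t, DecidablePred (H t)]
    {η : ℝ} (hη : η ≤ 1) (𝒯 : Finset T) (h : ∀ t ∈ 𝒯, η ≤ ∑ ω with H t ω, w ω) (N : ℕ) :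
    ∃ F : Finset Ω, #F ≤ N ∧ ∃ 𝒰 ⊆ 𝒯, (∀ t ∈ 𝒯, t ∉ 𝒰 → ∃ ω ∈ F, H t ω) ∧
      (#𝒰 : ℝ) ≤ (1 - η) ^ N * #𝒯 := by
  classical
  induction N with
  | zero => exact ⟨∅, by simp, 𝒯, by simp, by tauto, by simp⟩
  | succ N ih =>
    obtain ⟨F, hF, 𝒰, h𝒰, hhit, hle⟩ := ih
    -- By averaging, a single outcome hits at least an `η` fraction of the events still unhit.
    obtain ⟨ω₀, hω₀⟩ : ∃ ω, η * #𝒰 ≤ #{t ∈ 𝒰 | H t ω} := by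
      by_contra! hlt
      have h1 : ∑ ω, w ω * #{t ∈ 𝒰 | H t ω} < ∑ ω, w ω * (η * #𝒰) := by
        obtain ⟨ω, hω⟩ : ∃ ω, 0 < w ω := by
          by_contra! hneg
          have := sum_nonpos fun ω (_ : ω ∈ univ) => hneg ω
          linarith
        exact sum_lt_sum (fun ω _ => mul_le_mul_of_nonneg_left (hlt ω).le (hw ω))
          ⟨ω, mem_univ _, mul_lt_mul_of_pos_left (hlt ω) hω⟩
      rw [← sum_mul, hw1, one_mul] at h1
      have h2 : ∑ ω, w ω * (#{t ∈ 𝒰 | H t ω} : ℝ) = ∑ t ∈ 𝒰, ∑ ω with H t ω, w ω := by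
        simp_rw [sum_filter]
        rw [sum_comm]
        refine sum_congr rfl fun ω _ => ?_
        rw [← sum_filter, sum_const, nsmul_eq_mul, mul_comm]
      have h3 : ∑ t ∈ 𝒰, η ≤ ∑ t ∈ 𝒰, ∑ ω with H t ω, w ω :=
        sum_le_sum fun t ht => h t (h𝒰 ht)
      rw [sum_const, nsmul_eq_mul] at h3
      linarith
    refine ⟨insert ω₀ F, (card_insert_le _ _).trans (by omega), {t ∈ 𝒰 | ¬ H t ω₀},
      (filter_subset _ _).trans h𝒰, fun t ht htU => ?_, ?_⟩
    · by_cases h1 : t ∈ 𝒰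
      · exact ⟨ω₀, mem_insert_self _ _, by simpa [h1] using htU⟩
      · obtain ⟨ω, hω, h2⟩ := hhit t ht h1
        exact ⟨ω, mem_insert_of_mem hω, h2⟩
    have h5 : (#{t ∈ 𝒰 | H t ω₀} : ℝ) + #{t ∈ 𝒰 | ¬ H t ω₀} = #𝒰 := by
      exact_mod_cast card_filter_add_card_filter_not (s := 𝒰) fun t => H t ω₀
    rw [pow_succ]
    have h6 := mul_le_mul_of_nonneg_left hle (sub_nonneg.2 hη)
    linarith

/-- Used to cut a sample that exceeds a budget down to an excess of exactly one: initial segments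
grow by one element at a time. -/
theorem exists_card_filter_le_eq {α : Type*} [LinearOrder α] (A : Finset α) {b : ℕ}
    (hb : b < #A) : ∃ x ∈ A, #{z ∈ A | z ≤ x} = b + 1 := by
  induction A using Finset.induction_on_max with
  | empty => simp at hb
  | insert a A hA ih =>
    have ha : a ∉ A := fun h => lt_irrefl _ (hA a h)
    rw [card_insert_of_notMem ha] at hb
    by_cases h : b < #A
    · obtain ⟨x, hx, hc⟩ := ih h
      refine ⟨x, mem_insert_of_mem hx, ?_⟩
      rw [filter_insert, if_neg (not_le.2 (hA x hx)), hc]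
    · refine ⟨a, mem_insert_self _ _, ?_⟩
      rw [filter_true_of_mem, card_insert_of_notMem ha]
      · omega
      · intro z hz
        rcases mem_insert.1 hz with rfl | hz
        · exact le_rfl
        · exact (hA z hz).le

/-- With `T` the number of targets, fewer than one target stays unhit, hence none. -/
theorem mul_one_sub_pow_lt_one {n N : ℕ} {η : ℝ} (hη : η ≤ 1)
    (hN : (2 * n + 1) * (n + 1) ≤ η * N) {T : ℝ} (hT : T ≤ (n + 1 : ℝ) ^ (2 * n + 1)) :
    (1 - η) ^ N * T < 1 := by
  have h1 : (1 - η) ^ N ≤ Real.exp (-((2 * n + 1) * (n + 1))) := by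
    calc (1 - η) ^ N ≤ Real.exp (-η) ^ N :=
          pow_le_pow_left₀ (by linarith) (by linarith [Real.add_one_le_exp (-η)]) _
      _ = Real.exp (-(η * N)) := by rw [← Real.exp_nat_mul]; ring_nf
      _ ≤ _ := Real.exp_le_exp.2 (by linarith)
  have h2 : T ≤ Real.exp ((2 * n + 1) * n) := by
    calc T ≤ (n + 1 : ℝ) ^ (2 * n + 1) := hT
      _ ≤ Real.exp n ^ (2 * n + 1) := by
          gcongr
          exact Real.add_one_le_exp _
      _ = _ := by rw [← Real.exp_nat_mul]; push_cast; ring_nf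
  calc (1 - η) ^ N * T ≤ (1 - η) ^ N * Real.exp ((2 * n + 1) * n) :=
        mul_le_mul_of_nonneg_left h2 (pow_nonneg (by linarith) _)
    _ ≤ Real.exp (-((2 * n + 1) * (n + 1))) * Real.exp ((2 * n + 1) * n) := by gcongr
    _ = Real.exp (-(2 * n + 1)) := by rw [← Real.exp_add]; ring_nf
    _ < 1 := Real.exp_lt_one_iff.2 (by linarith [(Nat.cast_nonneg n : (0 : ℝ) ≤ n)])

/-- A small family of sets which, for every colouring and all budgets, contains a set that
exceeds its budget by one in the colour `i` and in no other colour, provided that a random set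
exceeds its budget in the colour `i` only with a probability that is not too small. -/
theorem exists_isolating_family {n N : ℕ} {η : ℝ} (hη : η ≤ 1)
    (hN : (2 * n + 1) * (n + 1) ≤ η * N) :
    ∃ 𝓕 : Finset (Finset (Fin n)), #𝓕 ≤ N * n ∧
      ∀ (κ : Fin n → Fin n) (b : Fin n → ℕ) (i : Fin n) (p : ℝ), (∀ e, b e ≤ n) →
        0 ≤ p → p ≤ 1 →
        (n + 1) * η ≤ sampleProb p univ (fun S => b i < #{x ∈ S | κ x = i} ∧
          ∀ j, j ≠ i → #{x ∈ S | κ x = j} ≤ b j) →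
        ∃ D ∈ 𝓕, #{x ∈ D | κ x = i} = b i + 1 ∧ ∀ j, j ≠ i → #{x ∈ D | κ x = j} ≤ b j := by
  classical
  -- A target is a colouring, budgets in `{0, …, n}` and a distinguished colour.
  let T := (Fin n → Fin n) × (Fin n → Fin (n + 1)) × Fin n
  let H : T → Finset (Fin n) → Prop := fun t S =>
    (t.2.1 t.2.2 : ℕ) < #{x ∈ S | t.1 x = t.2.2} ∧
      ∀ j, j ≠ t.2.2 → #{x ∈ S | t.1 x = j} ≤ t.2.1 j
  let 𝒯 : Finset T := {t | η ≤ ∑ S with H t S, mixedWeight S}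
  obtain ⟨F, hF, 𝒰, -, hhit, hle⟩ := exists_finset_card_unhit_le mixedWeight mixedWeight_nonneg
    sum_mixedWeight H hη 𝒯 (fun t ht => (mem_filter.1 ht).2) N
  have hcard : (#𝒯 : ℝ) ≤ (n + 1 : ℝ) ^ (2 * n + 1) := by
    have h1 : #𝒯 ≤ n ^ n * ((n + 1) ^ n * n) := by
      refine (card_le_univ 𝒯).trans (le_of_eq ?_)
      simp [T, Fintype.card_prod]
    have h2 : n ^ n * ((n + 1) ^ n * n) ≤ (n + 1) ^ (2 * n + 1) := by
      calc n ^ n * ((n + 1) ^ n * n) ≤ (n + 1) ^ n * ((n + 1) ^ n * (n + 1)) := by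
            gcongr <;> omega
        _ = _ := by ring
    exact_mod_cast h1.trans h2
  have hempty : 𝒰 = ∅ := by
    have := hle.trans_lt (mul_one_sub_pow_lt_one hη hN hcard)
    exact card_eq_zero.1 (Nat.lt_one_iff.1 (by exact_mod_cast this))
  -- All initial segments of the hitting sets are taken, which costs the factor `n`. Truncation
  -- cannot raise the count of any other colour.
  refine ⟨(F ×ˢ univ).image fun X => X.1.filter (· ≤ X.2), ?_, ?_⟩
  · refine card_image_le.trans ?_
    rw [card_product, card_univ, Fintype.card_fin]
    exact Nat.mul_le_mul_right _ hF
  · intro κ b i p hb hp hp' hprob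
    let t : T := (κ, fun e => ⟨b e, Nat.lt_succ_of_le (hb e)⟩, i)
    have ht : t ∈ 𝒯 := by
      refine mem_filter.2 ⟨mem_univ _, ?_⟩
      have h1 := hprob.trans (sampleProb_le_mixedWeight hp hp' _)
      rw [Fintype.card_fin] at h1
      have h2 : (0 : ℝ) < n + 1 := by positivity
      have h3 := le_of_mul_le_mul_left h1 h2
      exact h3
    obtain ⟨S, hS, hSi, hSj⟩ : ∃ S ∈ F, H t S := hhit t ht (by simp [hempty])
    obtain ⟨x, -, hx⟩ := exists_card_filter_le_eq {x ∈ S | κ x = i} hSi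
    refine ⟨{z ∈ S | z ≤ x}, mem_image.2 ⟨(S, x), by simp [hS], rfl⟩, ?_, fun j hj => ?_⟩
    · rw [filter_comm]
      exact hx
    · exact (card_le_card (filter_subset_filter _ (filter_subset _ _))).trans (hSj j hj)

/-- If the budgets are rarely exceeded, then the events that a given budget is exceeded are almost
disjoint. -/
theorem half_le_sampleProb_isolated {n : ℕ} (κ : Fin n → Fin n) (b : Fin n → ℕ) (i : Fin n)
    {p : ℝ} (hp : 0 ≤ p) (hp' : p ≤ 1)
    (h : ∑ j, sampleProb p {x | κ x = j} (fun S => b j < #S) ≤ 1 / 2) :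
    sampleProb p {x | κ x = i} (fun S => b i < #S) / 2 ≤
      sampleProb p univ (fun S => b i < #{x ∈ S | κ x = i} ∧
        ∀ j, j ≠ i → #{x ∈ S | κ x = j} ≤ b j) := by
  classical
  set A : Fin n → Finset (Fin n) := fun j => {x | κ x = j} with hA
  have hint : ∀ (S : Finset (Fin n)) j, S ∩ A j = {x ∈ S | κ x = j} := fun S j => by
    ext x; simp [hA]
  let H : Finset (Fin n) → Prop := fun S => ∀ j, j ≠ i → #{x ∈ S | κ x = j} ≤ b j
  have hH : ∀ S, H (S ∩ (univ \ A i)) ↔ H S := by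
    intro S
    refine forall_congr' fun j => forall_congr' fun hj => ?_
    have : {x ∈ S ∩ (univ \ A i) | κ x = j} = {x ∈ S | κ x = j} := by
      ext x
      simp only [hA, mem_filter, mem_inter, mem_sdiff, mem_univ, true_and]
      constructor
      · tauto
      · rintro ⟨h1, rfl⟩
        exact ⟨⟨h1, hj⟩, rfl⟩
    rw [this]
  -- The event `H` depends only on the complement of `A i`, hence is independent of the sample in `A
  -- i`.
  have h1 : sampleProb p univ (fun S => b i < #{x ∈ S | κ x = i} ∧ H S) =
      sampleProb p (A i) (fun S => b i < #S) * sampleProb p univ H := by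
    rw [← sampleProb_congr p univ (fun S _ => hH S), sampleProb_inter p (sdiff_subset),
      ← sampleProb_union p disjoint_sdiff, union_sdiff_of_subset (subset_univ _)]
    refine sampleProb_congr p univ fun S _ => ?_
    simp only [hH, hint]
  have h2 : sampleProb p univ (fun S => ¬ H S) ≤ 1 / 2 := by
    refine le_trans ?_ h
    refine (sampleProb_mono hp hp' univ (H := fun S => ∃ j ∈ univ, b j < #(S ∩ A j)) ?_).trans
      ((sampleProb_exists_le hp hp' univ univ _).trans (le_of_eq ?_))
    · intro S _ hS
      simp only [H, not_forall, not_le] at hS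
      obtain ⟨j, -, hj⟩ := hS
      exact ⟨j, mem_univ _, by rwa [hint]⟩
    · exact sum_congr rfl fun j _ => sampleProb_inter p (subset_univ _) fun S => b j < #S
  have h3 := sampleProb_not_add p univ H
  have h4 := sampleProb_nonneg hp hp' (A i) fun S => b i < #S
  rw [h1]
  nlinarith

end Isolation

/-! ### The potential argument bounding the number of steps. -/

section Convergence

open Finset

/-- A potential for sampling rates which increases by one when a rate `p` grows by a standard
deviation of the relative size of a random subset of a set of size `s`. -/
noncomputable def ratePotential (s p : ℝ) : ℝ :=
  Real.logb 2 p + 3 * √(2 * s) * √p - 2 * √(2 * s) * √(1 - p)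

theorem ratePotential_mono (s : ℝ) {p q : ℝ} (hp : 0 < p) (hpq : p ≤ q) :
    ratePotential s p ≤ ratePotential s q := by
  have h1 : Real.logb 2 p ≤ Real.logb 2 q := Real.logb_le_logb_of_le one_lt_two hp hpq
  have h2 : √p ≤ √q := Real.sqrt_le_sqrt hpq
  have h3 : √(1 - q) ≤ √(1 - p) := Real.sqrt_le_sqrt (by linarith)
  have hw := Real.sqrt_nonneg (2 * s)
  have h4 := mul_le_mul_of_nonneg_left h2 hw
  have h5 := mul_le_mul_of_nonneg_left h3 hw
  unfold ratePotential
  linarith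

/-- Each term handles one range of rates. For `p ≤ 1/2` the hypothesis gives `√(2s) (q - p) ≥ √p`:
if `√(2s) √p < 1` the rate doubles and the logarithm gains one, otherwise the `√p` term does. For `p
> 1/2` the `√(1 - p)` term gains one. -/
theorem ratePotential_add_one_le {s p q : ℝ} (hs : 0 < s) (hp : 0 < p) (hpq : p ≤ q)
    (hq : q < 1) (h : p * (1 - p) ≤ s * (q - p) ^ 2) :
    ratePotential s p + 1 ≤ ratePotential s q := by
  have h1 : Real.logb 2 p ≤ Real.logb 2 q := Real.logb_le_logb_of_le one_lt_two hp hpq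
  have h2 : √p ≤ √q := Real.sqrt_le_sqrt hpq
  have h3 : √(1 - q) ≤ √(1 - p) := Real.sqrt_le_sqrt (by linarith)
  have hw : 0 < √(2 * s) := by positivity
  have hw2 : √(2 * s) ^ 2 = 2 * s := Real.sq_sqrt (by positivity)
  have hx : 0 < √p := Real.sqrt_pos.2 hp
  have hx2 : √p ^ 2 = p := Real.sq_sqrt hp.le
  have hy2 : √q ^ 2 = q := Real.sq_sqrt (hp.le.trans hpq)
  have hu : 0 < √(1 - p) := Real.sqrt_pos.2 (by linarith)
  have hu2 : √(1 - p) ^ 2 = 1 - p := Real.sq_sqrt (by linarith)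
  have hv2 : √(1 - q) ^ 2 = 1 - q := Real.sq_sqrt (by linarith)
  have h4 := mul_le_mul_of_nonneg_left h2 hw.le
  have h5 := mul_le_mul_of_nonneg_left h3 hw.le
  unfold ratePotential
  generalize √(2 * s) = w at *
  generalize √(1 - p) = u at *
  generalize √(1 - q) = v at *
  generalize √p = x at *
  generalize √q = y at *
  have hwq : 0 ≤ w * (q - p) := mul_nonneg hw.le (by linarith)
  have hsq : 2 * (p * (1 - p)) ≤ (w * (q - p)) ^ 2 := by
    rw [mul_pow, hw2]
    linarith
  rcases le_or_gt p (1 / 2) with hp2 | hp2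
  · have hxw : x ≤ w * (q - p) := by
      refine abs_le_of_sq_le_sq' ?_ hwq |>.2
      rw [hx2]
      nlinarith
    rcases lt_or_ge (w * x) 1 with hwx | hwx
    · have hdouble : 2 * p ≤ q := by
        have : w * p ≤ w * (q - p) := by
          rw [← hx2] at hxw ⊢
          nlinarith
        linarith [le_of_mul_le_mul_left this hw]
      have h6 := Real.logb_le_logb_of_le one_lt_two (by positivity) hdouble
      rw [Real.logb_mul two_ne_zero hp.ne', Real.logb_self_eq_one one_lt_two] at h6
      linarith
    · have h7 : 1 ≤ 3 * (w * y - w * x) := by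
        by_contra! hlt
        have h8 : w * (w * (q - p)) < w * x := by
          have : w * (w * (q - p)) = (w * y - w * x) * (w * y + w * x) := by
            rw [← hx2, ← hy2]
            ring
          rw [this]
          nlinarith
        linarith [mul_le_mul_of_nonneg_left hxw hw.le]
      linarith
  · have huw : u ≤ w * (q - p) := by
      refine abs_le_of_sq_le_sq' ?_ hwq |>.2
      rw [hu2]
      nlinarith
    have h7 : 1 ≤ 2 * (w * u - w * v) := by
      have h8 : w * (q - p) = (w * u - w * v) * (u + v) := by
        have : q - p = u ^ 2 - v ^ 2 := by rw [hu2, hv2]; ring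
        rw [this]
        ring
      have h9 : u * 1 ≤ u * (2 * (w * u - w * v)) := by nlinarith
      exact le_of_mul_le_mul_left h9 hu
    linarith

theorem ratePotential_le {s p : ℝ} (hp : 0 < p) (hp' : p ≤ 1) :
    ratePotential s p ≤ 3 * √(2 * s) := by
  have h1 : Real.logb 2 p ≤ 0 := Real.logb_nonpos one_lt_two hp.le hp'
  have h2 : √p ≤ 1 := Real.sqrt_le_one.2 hp'
  have h3 := Real.sqrt_nonneg (1 - p)
  have hw := Real.sqrt_nonneg (2 * s)
  unfold ratePotential
  nlinarith

theorem logb_sub_le_ratePotential {s p : ℝ} (hp : 0 ≤ p) :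
    Real.logb 2 p - 2 * √(2 * s) ≤ ratePotential s p := by
  have h2 : √(1 - p) ≤ 1 := Real.sqrt_le_one.2 (by linarith)
  have h3 := Real.sqrt_nonneg p
  have hw := Real.sqrt_nonneg (2 * s)
  unfold ratePotential
  nlinarith [mul_nonneg hw h3]

theorem card_large_mul_le {n : ℕ} (κ : Fin n → Fin n) (s : ℝ) :
    (#{j | s < (#{x | κ x = j} : ℝ)} : ℝ) * s ≤ n := by
  have h1 : ∑ j, #{x | κ x = j} = n := by
    simpa using (card_eq_sum_card_fiberwise (f := κ) (s := univ) (t := univ) (by simp)).symm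
  calc (#{j | s < (#{x | κ x = j} : ℝ)} : ℝ) * s
      = ∑ j with s < (#{x | κ x = j} : ℝ), s := by rw [sum_const, nsmul_eq_mul]
    _ ≤ ∑ j with s < (#{x | κ x = j} : ℝ), (#{x | κ x = j} : ℝ) :=
        sum_le_sum fun j hj => (mem_filter.1 hj).2.le
    _ ≤ ∑ j, (#{x | κ x = j} : ℝ) :=
        sum_le_sum_of_subset_of_nonneg (filter_subset _ _) fun _ _ _ => Nat.cast_nonneg _
    _ = n := by exact_mod_cast h1

/-- The probability that the colour `j` exceeds its budget at the sampling rate `p`. -/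
noncomputable def excessProb {n : ℕ} (κ : Fin n → Fin n) (b : Fin n → ℕ) (j : Fin n) (p : ℝ) : ℝ :=
  sampleProb p {x | κ x = j} fun S => b j < #S

theorem excessProb_nonneg {n : ℕ} (κ : Fin n → Fin n) (b : Fin n → ℕ) (j : Fin n) {p : ℝ}
    (hp : 0 ≤ p) (hp' : p ≤ 1) : 0 ≤ excessProb κ b j p :=
  sampleProb_nonneg hp hp' _ _

theorem excessProb_le {n : ℕ} (κ : Fin n → Fin n) (b : Fin n → ℕ) (j : Fin n) {p : ℝ}
    (hp : 0 ≤ p) (hp' : p ≤ 1) : excessProb κ b j p ≤ n * p := by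
  refine (sampleProb_mono hp hp' _ fun S _ hS => ?_).trans
    ((sampleProb_nonempty_le hp hp' _).trans ?_)
  · exact card_pos.1 (by omega)
  · gcongr
    simpa using card_le_univ {x | κ x = j}

theorem excessProb_eq_zero {n : ℕ} (κ : Fin n → Fin n) (b : Fin n → ℕ) (j : Fin n) (p : ℝ)
    (h : #{x | κ x = j} ≤ b j) : excessProb κ b j p = 0 := by
  refine sampleProb_eq_zero p fun S hS => ?_
  have := card_le_card hS
  omega

/-- Intermediate values: at rate one an overfull colour is exceeded with certainty. -/
theorem exists_rate_of_lt_card {n : ℕ} (κ : Fin n → Fin n) (b : Fin n → ℕ) (J : Finset (Fin n))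
    {τ : ℝ} (hτ : 0 < τ) (hτ' : τ < 1) (hle : ∑ j ∈ J, excessProb κ b j τ ≤ 1 / 2)
    (hJ : ∃ i ∈ J, b i < #{x | κ x = i}) :
    ∃ q, τ ≤ q ∧ q < 1 ∧ ∑ j ∈ J, excessProb κ b j q = 1 / 2 := by
  obtain ⟨i, hi, hbi⟩ := hJ
  have h1 : 1 ≤ ∑ j ∈ J, excessProb κ b j 1 :=
    (sampleProb_one _ hbi).symm.le.trans
      (single_le_sum (f := fun j => excessProb κ b j 1)
        (fun j _ => excessProb_nonneg κ b j zero_le_one le_rfl) hi)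
  have hc : Continuous fun p => ∑ j ∈ J, excessProb κ b j p :=
    continuous_finsetSum _ fun j _ => sampleProb_continuous _ _
  obtain ⟨q, hq, hq2⟩ := intermediate_value_Icc hτ'.le hc.continuousOn
    (⟨hle, by linarith⟩ : (1 / 2 : ℝ) ∈ Set.Icc _ _)
  refine ⟨q, hq.1, lt_of_le_of_ne hq.2 ?_, hq2⟩
  rintro rfl
  simp only at hq2
  linarith

/-- Suppose that in each step every active colour is deactivated which is exceeded with a
probability that is not too small at some sampling rate at which it is unlikely that an active
colour is exceeded. Then after few steps no active colour can be exceeded. -/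
theorem card_le_of_mem_of_steps {n : ℕ} (hn : 0 < n) (κ : Fin n → Fin n) (b : Fin n → ℕ)
    (J : ℕ → Finset (Fin n)) (hJ : ∀ r, J (r + 1) ⊆ J r)
    (hstep : ∀ r, ∀ i ∈ J r, ∀ p : ℝ, 0 ≤ p → p ≤ 1 → ∑ j ∈ J r, excessProb κ b j p ≤ 1 / 2 →
      1 / (12 * (n : ℝ) ^ 2) ≤ excessProb κ b i p → i ∉ J (r + 1))
    {s : ℝ} (hs : 0 < s) {R : ℕ}
    (hR : 5 * √(2 * s) + n / s + Real.logb 2 (13 * (n : ℝ) ^ 3) < R) :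
    ∀ e ∈ J R, #{x | κ x = e} ≤ b e := by
  have hn1 : (1 : ℝ) ≤ n := by exact_mod_cast hn
  have hn2 : (1 : ℝ) ≤ (n : ℝ) ^ 2 := one_le_pow₀ hn1
  have hn3 : (1 : ℝ) ≤ (n : ℝ) ^ 3 := one_le_pow₀ hn1
  set L : Finset (Fin n) := {j | s < (#{x | κ x = j} : ℝ)} with hL
  -- Small enough that `n τ₀ < 1 / (12 n²)` strictly, so every colour starts below the threshold.
  set τ₀ : ℝ := 1 / (13 * (n : ℝ) ^ 3) with hτ₀
  have hcardJ : ∀ r, (#(J r) : ℝ) ≤ n := fun r => by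
    exact_mod_cast (card_le_univ (J r)).trans (by simp)
  -- Invariant: each step is paid for by one unit of potential or by one more settled large colour.
  have hinv : ∀ r : ℕ, (∀ e ∈ J r, #{x | κ x = e} ≤ b e) ∨
      ∃ τ : ℝ, 0 < τ ∧ τ < 1 ∧ ∑ j ∈ J r, excessProb κ b j τ ≤ 1 / 2 ∧
        (∀ j ∈ J r, excessProb κ b j τ < 1 / (12 * (n : ℝ) ^ 2)) ∧
        ratePotential s τ₀ + r ≤ ratePotential s τ + #(L \ J r) := by
    intro r
    induction r with
    | zero =>
      right
      have h0 : 0 < τ₀ := by positivity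
      have h1 : τ₀ < 1 := by
        rw [hτ₀, div_lt_one (by positivity)]
        linarith
      have h2 : n * τ₀ < 1 / (12 * (n : ℝ) ^ 2) := by
        rw [hτ₀, mul_one_div, div_lt_div_iff₀ (by positivity) (by positivity)]
        nlinarith
      have h3 : ∀ j, excessProb κ b j τ₀ < 1 / (12 * (n : ℝ) ^ 2) := fun j =>
        (excessProb_le κ b j h0.le h1.le).trans_lt h2
      refine ⟨τ₀, h0, h1, ?_, fun j _ => h3 j, by simp⟩
      calc ∑ j ∈ J 0, excessProb κ b j τ₀ ≤ #(J 0) • (n * τ₀) :=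
            sum_le_card_nsmul _ _ _ fun j _ => excessProb_le κ b j h0.le h1.le
        _ ≤ n * (n * τ₀) := by
            rw [nsmul_eq_mul]
            exact mul_le_mul_of_nonneg_right (hcardJ 0) (by positivity)
        _ ≤ 1 / 2 := by
            rw [hτ₀, mul_one_div, mul_div_assoc', div_le_div_iff₀ (by positivity) (by positivity)]
            nlinarith
    | succ r ih =>
      rcases ih with ih | ⟨τ, h0, h1, hsum, hlow, hpot⟩
      · exact Or.inl fun e he => ih e (hJ r he)
      by_cases hdone : ∀ e ∈ J r, #{x | κ x = e} ≤ b e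
      · exact Or.inl fun e he => hdone e (hJ r he)
      right
      push Not at hdone
      obtain ⟨q, hτq, hq1, hq⟩ := exists_rate_of_lt_card κ b (J r) h0 h1 hsum hdone
      have hq0 : 0 < q := h0.trans_le hτq
      obtain ⟨i, hi, hiq⟩ : ∃ i ∈ J r, 1 / (2 * (n : ℝ)) ≤ excessProb κ b i q := by
        by_contra! hlt
        have h2 : ∑ j ∈ J r, excessProb κ b j q < ∑ j ∈ J r, 1 / (2 * (n : ℝ)) :=
          sum_lt_sum_of_nonempty ⟨hdone.choose, hdone.choose_spec.1⟩ hlt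
        rw [sum_const, nsmul_eq_mul, hq] at h2
        have h3 := mul_le_mul_of_nonneg_right (hcardJ r)
          (by positivity : 0 ≤ 1 / (2 * (n : ℝ)))
        have h4 : (n : ℝ) * (1 / (2 * n)) = 1 / 2 := by field_simp
        linarith
      have hδ : 1 / (12 * (n : ℝ) ^ 2) ≤ 1 / (2 * (n : ℝ)) :=
        one_div_le_one_div_of_le (by positivity) (by nlinarith)
      have hi' : i ∉ J (r + 1) := hstep r i hi q hq0.le hq1.le hq.le (hδ.trans hiq)
      refine ⟨q, hq0, hq1, ?_, fun j hj => ?_, ?_⟩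
      · rw [← hq]
        exact sum_le_sum_of_subset_of_nonneg (hJ r) fun j _ _ =>
          excessProb_nonneg κ b j hq0.le hq1.le
      · by_contra! hge
        exact hstep r j (hJ r hj) q hq0.le hq1.le hq.le hge hj
      -- This is the origin of the threshold: `(1 / (2n))² / 3 = 1 / (12 n²)`.
      · have hgap : τ * (1 - τ) < #{x | κ x = i} * (q - τ) ^ 2 := by
          by_contra! hle
          have h2 := sq_div_three_le_sampleProb h0 h1 q _ (fun S => b i < #S) hle
          have h3 := hlow i hi
          have h4 : (1 / (2 * (n : ℝ))) ^ 2 ≤ excessProb κ b i q ^ 2 :=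
            pow_le_pow_left₀ (by positivity) hiq 2
          have h5 : (1 / (2 * (n : ℝ))) ^ 2 / 3 = 1 / (12 * (n : ℝ) ^ 2) := by
            field_simp
            norm_num
          unfold excessProb at *
          linarith
        have hsub : L \ J r ⊆ L \ J (r + 1) := sdiff_subset_sdiff le_rfl (hJ r)
        push_cast
        by_cases hiL : i ∈ L
        · have h2 : #(L \ J r) < #(L \ J (r + 1)) :=
            card_lt_card ⟨hsub, fun hsup =>
              (mem_sdiff.1 (hsup (mem_sdiff.2 ⟨hiL, hi'⟩))).2 hi⟩
          have h3 : (#(L \ J r) : ℝ) + 1 ≤ #(L \ J (r + 1)) := by exact_mod_cast h2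
          linarith [ratePotential_mono s h0 hτq]
        · have h2 : (#(L \ J r) : ℝ) ≤ #(L \ J (r + 1)) := by exact_mod_cast card_le_card hsub
          have h3 : (#{x | κ x = i} : ℝ) ≤ s := by simpa [hL] using hiL
          have h4 := mul_le_mul_of_nonneg_right h3 (sq_nonneg (q - τ))
          linarith [ratePotential_add_one_le hs h0 hτq hq1 (hgap.le.trans h4)]
  rcases hinv R with h | ⟨τ, h0, h1, -, -, hpot⟩
  · exact h
  · exfalso
    have h2 : (#(L \ J R) : ℝ) ≤ n / s := by
      rw [le_div_iff₀ hs]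
      refine le_trans ?_ (card_large_mul_le κ s)
      gcongr
      exact sdiff_subset
    have h3 := ratePotential_le (s := s) h0 h1.le
    have h4 := logb_sub_le_ratePotential (s := s) (p := τ₀) (by positivity)
    rw [hτ₀, one_div, Real.logb_inv, ← one_div, ← hτ₀] at h4
    linarith

end Convergence

/-! ### Adaptive algorithms with two rounds per iteration. -/

section Loop

open Finset

namespace QueryAlgorithm

variable {E σ : Type*}

theorem numQueries_le {q : ℕ} {o : Finset E → Bool} {alg : QueryAlgorithm E}
    (h : ∀ c ∈ alg.queryCounts o, c ≤ q) : alg.numQueries o ≤ alg.numRounds o * q := by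
  simpa [numQueries, numRounds] using List.sum_le_card_nsmul _ q h

variable [DecidableEq E]

/-- The answers to the queries in `Q`, extended by `false` to all sets. -/
def extendAnswers (Q : Finset (Finset E)) (a : {S // S ∈ Q} → Bool) (S : Finset E) : Bool :=
  if h : S ∈ Q then a ⟨S, h⟩ else false

theorem extendAnswers_of_mem {Q : Finset (Finset E)} (o : Finset E → Bool) {S : Finset E}
    (h : S ∈ Q) : extendAnswers Q (fun T => o T.1) S = o S :=
  dif_pos h

/-- The algorithm that performs `k` iterations of two adaptive rounds each, starting from a given
state: the queries of the first round depend on the state, those of the second round also on the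
answers of the first, and all the answers determine the next state. -/
def twoRoundLoop (Q₁ : σ → Finset (Finset E))
    (Q₂ : σ → (Finset E → Bool) → Finset (Finset E))
    (step : σ → (Finset E → Bool) → (Finset E → Bool) → σ) (out : σ → Finset E) :
    ℕ → σ → QueryAlgorithm E
  | 0, s => output (out s)
  | k + 1, s =>
    round (Q₁ s) fun a₁ =>
      round (Q₂ s (extendAnswers _ a₁)) fun a₂ =>
        twoRoundLoop Q₁ Q₂ step out k (step s (extendAnswers _ a₁) (extendAnswers _ a₂))

variable {Q₁ : σ → Finset (Finset E)} {Q₂ : σ → (Finset E → Bool) → Finset (Finset E)}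
  {step : σ → (Finset E → Bool) → (Finset E → Bool) → σ} {out : σ → Finset E}

/-- Unqueried sets are answered `false`, so `hstep` must ensure that a step reads only queried sets.
-/
theorem twoRoundLoop_result {o : Finset E → Bool}
    (hstep : ∀ s o₁ o₂, (∀ S ∈ Q₁ s, o₁ S = o S) → (∀ S ∈ Q₂ s o₁, o₂ S = o S) →
      step s o₁ o₂ = step s o o) (k : ℕ) (s : σ) :
    (twoRoundLoop Q₁ Q₂ step out k s).result o = out ((fun s => step s o o)^[k] s) := by
  induction k generalizing s with
  | zero => rfl
  | succ k ih =>
    rw [twoRoundLoop, result, result, ih, Function.iterate_succ_apply]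
    rw [hstep s _ _ (fun S hS => extendAnswers_of_mem o hS) fun S hS => extendAnswers_of_mem o hS]

theorem twoRoundLoop_numRounds (o : Finset E → Bool) (k : ℕ) (s : σ) :
    (twoRoundLoop Q₁ Q₂ step out k s).numRounds o = 2 * k := by
  induction k generalizing s with
  | zero => rfl
  | succ k ih =>
    have := ih (step s (extendAnswers (Q₁ s) fun S => o S.1)
      (extendAnswers (Q₂ s (extendAnswers (Q₁ s) fun S => o S.1)) fun S => o S.1))
    unfold numRounds at this ⊢
    rw [twoRoundLoop, queryCounts, queryCounts, List.length_cons, List.length_cons, this]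
    ring

theorem le_of_mem_twoRoundLoop_queryCounts {q : ℕ} (h₁ : ∀ s, #(Q₁ s) ≤ q)
    (h₂ : ∀ s o, #(Q₂ s o) ≤ q) (o : Finset E → Bool) (k : ℕ) (s : σ) :
    ∀ c ∈ (twoRoundLoop Q₁ Q₂ step out k s).queryCounts o, c ≤ q := by
  induction k generalizing s with
  | zero => simp [twoRoundLoop, queryCounts]
  | succ k ih =>
    rw [twoRoundLoop, queryCounts, queryCounts]
    simp only [List.mem_cons, forall_eq_or_imp]
    exact ⟨h₁ _, h₂ _ _, ih _⟩

end QueryAlgorithm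

end Loop

/-! ### Correctness of one step on a coloured ground set. -/

section PartitionStep

open Finset

variable {E : Type*}

/-- A fixed subset of `A` with `k` elements, if there is one. -/
noncomputable def pickSubset (A : Finset E) (k : ℕ) : Finset E :=
  if h : k ≤ #A then (exists_subset_card_eq h).choose else ∅

theorem pickSubset_subset (A : Finset E) (k : ℕ) : pickSubset A k ⊆ A := by
  unfold pickSubset
  split_ifs with h
  · exact (exists_subset_card_eq h).choose_spec.1
  · exact empty_subset _

theorem card_pickSubset {A : Finset E} {k : ℕ} (h : k ≤ #A) : #(pickSubset A k) = k := by
  unfold pickSubset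
  rw [dif_pos h]
  exact (exists_subset_card_eq h).choose_spec.2

variable [DecidableEq E] {κ : E → E} {b : E → ℕ} {o : Finset E → Bool}

theorem oracle_singleton (ho : ∀ S, o S = true ↔ ∀ e, #{x ∈ S | κ x = e} ≤ b e) (y : E) :
    o {y} = true ↔ b (κ y) ≠ 0 := by
  rw [ho]
  constructor
  · intro h
    have := h (κ y)
    rw [filter_singleton, if_pos rfl, card_singleton] at this
    omega
  · intro h e
    rw [filter_singleton]
    split_ifs with he
    · subst he
      rw [card_singleton]
      omega
    · simp

variable [Fintype E]

/-- The first round: the traces on `U` of the sets of the family, and these traces with one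
element removed. -/
def traceQueries (𝓕 : Finset (Finset E)) (U : Finset E) : Finset (Finset E) :=
  𝓕.image (· ∩ U) ∪ (𝓕 ×ˢ univ).image fun X => (X.1 ∩ U).erase X.2

/-- The elements of the dependent traces whose removal makes the trace independent. -/
def foundCircuits (𝓕 : Finset (Finset E)) (U : Finset E) (o : Finset E → Bool) :
    Finset (Finset E) :=
  ((𝓕.image (· ∩ U)).filter fun D => o D = false).image fun D => D.filter fun y => o (D.erase y)

/-- The second round: single elements, and exchanges in circuits. -/
def exchangeQueries (𝒞 : Finset (Finset E)) : Finset (Finset E) :=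
  univ.image (fun y => {y}) ∪
    (𝒞 ×ˢ univ ×ˢ univ).image fun X => insert X.2.1 (X.1.erase X.2.2)

/-- The elements parallel to the elements of the circuit `C`. -/
def parallelClass (o : Finset E → Bool) (C : Finset E) : Finset E :=
  {y | o {y} = true ∧ ∃ x ∈ C, o (insert y (C.erase x)) = false}

/-- The step on a pair of the set of the elements not yet dealt with and of a basis of its
complement. -/
noncomputable def partitionStep (𝓕 : Finset (Finset E)) (s : Finset E × Finset E)
    (o₁ o₂ : Finset E → Bool) : Finset E × Finset E :=
  (s.1.filter fun y => o₂ {y} = true ∧ ∀ C ∈ foundCircuits 𝓕 s.1 o₁, y ∉ parallelClass o₂ C,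
    s.2 ∪ (foundCircuits 𝓕 s.1 o₁).biUnion fun C => pickSubset (parallelClass o₂ C) (#C - 1))

theorem foundCircuits_congr {𝓕 : Finset (Finset E)} {U : Finset E} {o o' : Finset E → Bool}
    (h : ∀ S ∈ traceQueries 𝓕 U, o' S = o S) :
    foundCircuits 𝓕 U o' = foundCircuits 𝓕 U o := by
  have h1 : ∀ D ∈ 𝓕.image (· ∩ U), o' D = o D := fun D hD => h D (mem_union_left _ hD)
  have h2 : ∀ D ∈ 𝓕.image (· ∩ U), ∀ y, o' (D.erase y) = o (D.erase y) := by
    intro D hD y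
    obtain ⟨X, hX, rfl⟩ := mem_image.1 hD
    exact h _ (mem_union_right _ (mem_image.2 ⟨(X, y), by simp [hX], rfl⟩))
  unfold foundCircuits
  rw [filter_congr (q := fun D => o D = false) fun D hD => by rw [h1 D hD]]
  refine image_congr fun D hD => ?_
  have hD' := (mem_filter.1 (mem_coe.1 hD)).1
  exact filter_congr fun y _ => by rw [h2 D hD' y]

theorem parallelClass_congr {𝒞 : Finset (Finset E)} {o o' : Finset E → Bool}
    (h : ∀ S ∈ exchangeQueries 𝒞, o' S = o S) {C : Finset E} (hC : C ∈ 𝒞) :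
    parallelClass o' C = parallelClass o C := by
  have h2 : ∀ x y, o' (insert y (C.erase x)) = o (insert y (C.erase x)) := fun x y =>
    h _ (mem_union_right _ (mem_image.2 ⟨(C, y, x), by simp [hC], rfl⟩))
  have h1 : ∀ y, o' {y} = o {y} := fun y => h _ (mem_union_left _ (by simp))
  simp only [parallelClass, h1, h2]

theorem partitionStep_congr {𝓕 : Finset (Finset E)} {s : Finset E × Finset E}
    {o o₁ o₂ : Finset E → Bool} (h₁ : ∀ S ∈ traceQueries 𝓕 s.1, o₁ S = o S)
    (h₂ : ∀ S ∈ exchangeQueries (foundCircuits 𝓕 s.1 o₁), o₂ S = o S) :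
    partitionStep 𝓕 s o₁ o₂ = partitionStep 𝓕 s o o := by
  rw [foundCircuits_congr h₁] at h₂
  have h3 : ∀ y, o₂ {y} = o {y} := fun y => h₂ _ (mem_union_left _ (by simp))
  unfold partitionStep
  rw [foundCircuits_congr h₁]
  congr 1
  · refine filter_congr fun y _ => ?_
    rw [h3]
    refine and_congr_right fun _ => forall₂_congr fun C hC => ?_
    rw [parallelClass_congr h₂ hC]
  · congr 1
    refine biUnion_congr rfl fun C hC => ?_
    rw [parallelClass_congr h₂ hC]

theorem card_traceQueries_le (𝓕 : Finset (Finset E)) (U : Finset E) :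
    #(traceQueries 𝓕 U) ≤ #𝓕 * (Fintype.card E + 1) := by
  refine (card_union_le _ _).trans ?_
  have h1 := card_image_le (s := 𝓕) (f := (· ∩ U))
  have h2 := card_image_le (s := 𝓕 ×ˢ (univ : Finset E)) (f := fun X => (X.1 ∩ U).erase X.2)
  rw [card_product, card_univ] at h2
  linarith

theorem card_exchangeQueries_le (𝓕 : Finset (Finset E)) (U : Finset E) (o : Finset E → Bool) :
    #(exchangeQueries (foundCircuits 𝓕 U o)) ≤
      Fintype.card E + #𝓕 * (Fintype.card E * Fintype.card E) := by
  refine (card_union_le _ _).trans (add_le_add ?_ ?_)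
  · exact card_image_le.trans card_univ.le
  · refine card_image_le.trans ?_
    rw [card_product, card_product, card_univ]
    refine Nat.mul_le_mul_right _ ?_
    exact card_image_le.trans ((card_le_card (filter_subset _ _)).trans card_image_le)

/-- A single deletion repairs a dependent trace only if exactly one budget is exceeded, by one; then
the repairing elements are precisely those of that colour. If the excess is larger, the found set is
empty. -/
theorem color_of_mem_foundCircuits (ho : ∀ S, o S = true ↔ ∀ e, #{x ∈ S | κ x = e} ≤ b e)
    {𝓕 : Finset (Finset E)} {U C : Finset E} (hC : C ∈ foundCircuits 𝓕 U o) (hne : C.Nonempty) :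
    ∃ i, (∀ x ∈ C, κ x = i) ∧ C ⊆ U ∧ #C = b i + 1 := by
  obtain ⟨D, hD, rfl⟩ := mem_image.1 hC
  obtain ⟨hDF, hdep⟩ := mem_filter.1 hD
  obtain ⟨X, -, rfl⟩ := mem_image.1 hDF
  set D := X ∩ U
  obtain ⟨i, hi⟩ : ∃ i, b i < #{x ∈ D | κ x = i} := by
    by_contra! h
    simp [(ho D).2 h] at hdep
  have hcol : ∀ y ∈ D, o (D.erase y) = true →
      κ y = i ∧ #{x ∈ D | κ x = i} = b i + 1 ∧ ∀ j, j ≠ i → #{x ∈ D | κ x = j} ≤ b j := by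
    intro y hy hoy
    have h1 := (ho _).1 hoy
    simp only [filter_erase] at h1
    have hyi : κ y = i := by
      by_contra hne
      have := h1 i
      rw [erase_eq_of_notMem (by simp [hne])] at this
      omega
    refine ⟨hyi, ?_, fun j hj => ?_⟩
    · have := h1 i
      rw [card_erase_of_mem (by simp [hy, hyi])] at this
      omega
    · have := h1 j
      rwa [erase_eq_of_notMem] at this
      simp only [mem_filter, not_and, hyi]
      exact fun _ h => hj h.symm
  obtain ⟨y, hy⟩ := hne
  obtain ⟨hyD, hoy⟩ := mem_filter.1 hy
  obtain ⟨hyi, hcard, hother⟩ := hcol y hyD hoy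
  refine ⟨i, fun x hx => (hcol x (mem_filter.1 hx).1 (mem_filter.1 hx).2).1,
    (filter_subset _ _).trans inter_subset_right, ?_⟩
  rw [← hcard]
  congr 1
  refine filter_congr fun z hz => ⟨fun h => (hcol z hz h).1, fun hzi => (ho _).2 fun e => ?_⟩
  rw [filter_erase]
  by_cases he : e = i
  · subst he
    rw [card_erase_of_mem (by simp [hz, hzi])]
    omega
  · exact (card_le_card (erase_subset _ _)).trans (hother e he)

/-- Exchanging an element of `C` for `y` restores the excess only if `y` has the same colour. The
singleton test excludes loops, which make any set dependent. -/
theorem parallelClass_eq (ho : ∀ S, o S = true ↔ ∀ e, #{x ∈ S | κ x = e} ≤ b e)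
    {C : Finset E} {i : E} (hC : ∀ x ∈ C, κ x = i) (hcard : #C = b i + 1) :
    parallelClass o C = if b i = 0 then ∅ else ({y | κ y = i} : Finset E) := by
  have hmem : ∀ y, y ∈ parallelClass o C ↔ b i ≠ 0 ∧ κ y = i := by
    intro y
    simp only [parallelClass, mem_filter, mem_univ, true_and, oracle_singleton ho]
    constructor
    · rintro ⟨hy, x, hx, hdep⟩
      have hyi : κ y = i := by
        by_contra hne
        have : o (insert y (C.erase x)) = true := by
          refine (ho _).2 fun e => ?_
          have hsub : {z ∈ C.erase x | κ z = e} ⊆ C.erase x := filter_subset _ _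
          by_cases he : e = i
          · subst he
            rw [filter_insert, if_neg hne]
            refine (card_le_card hsub).trans ?_
            rw [card_erase_of_mem hx]
            omega
          · have : {z ∈ C.erase x | κ z = e} = ∅ := by
              refine filter_eq_empty_iff.2 fun z hz h => he ?_
              rw [← h, hC z (mem_of_mem_erase hz)]
            rw [filter_insert, this]
            split_ifs with h
            · subst h
              simp only [insert_empty_eq, card_singleton]
              omega
            · simp
        simp [this] at hdep
      exact ⟨hyi ▸ hy, hyi⟩
    · rintro ⟨hb, rfl⟩
      refine ⟨hb, ?_⟩
      -- For `y ∈ C` the choice `x = y` gives back `C` itself.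
      obtain ⟨x, hx, hyx⟩ : ∃ x ∈ C, y ∉ C.erase x := by
        by_cases hy : y ∈ C
        · exact ⟨y, hy, notMem_erase _ _⟩
        · obtain ⟨x, hx⟩ := card_pos.1 (by omega : 0 < #C)
          exact ⟨x, hx, fun h => hy (mem_of_mem_erase h)⟩
      refine ⟨x, hx, ?_⟩
      by_contra hind
      rw [Bool.not_eq_false, ho] at hind
      have := hind (κ y)
      rw [filter_true_of_mem, card_insert_of_notMem hyx, card_erase_of_mem hx] at this
      · omega
      · intro z hz
        rcases mem_insert.1 hz with rfl | hz
        · rfl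
        · exact hC z (mem_of_mem_erase hz)
  ext y
  rw [hmem]
  split_ifs with h <;> simp [h]

/-- The state `s` has dealt with all colours except those in `J`. -/
def IsPartialState (κ : E → E) (b : E → ℕ) (J : Finset E) (s : Finset E × Finset E) : Prop :=
  (∀ x, x ∈ s.1 ↔ κ x ∈ J) ∧ ∀ e, #{x ∈ s.2 | κ x = e} = if e ∈ J then 0 else b e

/-- The colours that are still active after a step. -/
def remainingColors (𝓕 : Finset (Finset E)) (κ : E → E) (b : E → ℕ) (o : Finset E → Bool)
    (U J : Finset E) : Finset E :=
  {e ∈ J | b e ≠ 0 ∧ ∀ C ∈ foundCircuits 𝓕 U o, ∀ x ∈ C, κ x ≠ e}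

theorem remainingColors_subset (𝓕 : Finset (Finset E)) (κ : E → E) (b : E → ℕ)
    (o : Finset E → Bool) (U J : Finset E) : remainingColors 𝓕 κ b o U J ⊆ J :=
  filter_subset _ _

theorem IsPartialState.step (ho : ∀ S, o S = true ↔ ∀ e, #{x ∈ S | κ x = e} ≤ b e)
    (hb : ∀ e, b e ≤ #{x | κ x = e}) {J : Finset E} {s : Finset E × Finset E}
    (h : IsPartialState κ b J s) (𝓕 : Finset (Finset E)) :
    IsPartialState κ b (remainingColors 𝓕 κ b o s.1 J) (partitionStep 𝓕 s o o) := by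
  obtain ⟨hU, hB⟩ := h
  have hpar0 : parallelClass o ∅ = ∅ := by simp [parallelClass]
  constructor
  · intro y
    simp only [partitionStep, remainingColors, mem_filter, hU, oracle_singleton ho]
    refine and_congr_right fun _ => and_congr_right fun hby => forall₂_congr fun C hC => ?_
    rcases C.eq_empty_or_nonempty with rfl | hne
    · simp [hpar0]
    · obtain ⟨i, hCi, -, hcard⟩ := color_of_mem_foundCircuits ho hC hne
      rw [parallelClass_eq ho hCi hcard]
      constructor
      · intro hy x hx hxy
        have hyi : κ y = i := by rw [← hxy, hCi x hx]
        rw [if_neg (hyi ▸ hby)] at hy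
        exact hy (by simp [hyi])
      · intro hy hmem
        obtain ⟨x, hx⟩ := hne
        refine hy x hx ?_
        rw [hCi x hx]
        split_ifs at hmem
        · simp at hmem
        · exact (mem_filter.1 hmem).2.symm
  · intro e
    set 𝒞 := foundCircuits 𝓕 s.1 o with h𝒞
    -- All circuits of one colour yield the same class and size, hence the same picked subset, so
    -- their union does not overshoot the budget.
    have hpick : {x ∈ 𝒞.biUnion fun C => pickSubset (parallelClass o C) (#C - 1) | κ x = e} =
        if ∃ C ∈ 𝒞, ∃ x ∈ C, κ x = e then pickSubset {x | κ x = e} (b e) else ∅ := by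
      have hC : ∀ C ∈ 𝒞, C.Nonempty → ∃ i, (∀ x ∈ C, κ x = i) ∧
          pickSubset (parallelClass o C) (#C - 1) = pickSubset {x | κ x = i} (b i) := by
        intro C hC hne
        obtain ⟨i, hCi, -, hcard⟩ := color_of_mem_foundCircuits ho hC hne
        refine ⟨i, hCi, ?_⟩
        rw [parallelClass_eq ho hCi hcard, hcard, Nat.add_sub_cancel]
        split_ifs with h0
        · rw [h0, card_eq_zero.1 (card_pickSubset (Nat.zero_le _)),
            card_eq_zero.1 (card_pickSubset (Nat.zero_le _))]
        · rfl
      have hcolor : ∀ i y, y ∈ pickSubset {x | κ x = i} (b i) → κ y = i := fun i y hy =>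
        (mem_filter.1 (pickSubset_subset _ _ hy)).2
      ext y
      simp only [mem_filter, mem_biUnion]
      constructor
      · rintro ⟨⟨C, hCm, hy⟩, rfl⟩
        have hne : C.Nonempty := by
          rw [nonempty_iff_ne_empty]
          rintro rfl
          have := pickSubset_subset _ _ hy
          simp [hpar0] at this
        obtain ⟨i, hCi, hpi⟩ := hC C hCm hne
        rw [hpi] at hy
        have hyi := hcolor i y hy
        obtain ⟨x, hx⟩ := hne
        rw [if_pos ⟨C, hCm, x, hx, by rw [hCi x hx, hyi]⟩, hyi]
        exact hy
      · intro hy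
        split_ifs at hy with hex
        · obtain ⟨C, hCm, x, hx, hxe⟩ := hex
          obtain ⟨i, hCi, hpi⟩ := hC C hCm ⟨x, hx⟩
          have hie : i = e := by rw [← hxe, hCi x hx]
          refine ⟨⟨C, hCm, ?_⟩, hcolor e y hy⟩
          rw [hpi, hie]
          exact hy
        · simp at hy
    change #{x ∈ s.2 ∪ _ | κ x = e} = _
    rw [filter_union, hpick]
    have hBe := hB e
    by_cases heJ : e ∈ J
    · rw [if_pos heJ, card_eq_zero] at hBe
      rw [hBe, empty_union]
      by_cases hex : ∃ C ∈ 𝒞, ∃ x ∈ C, κ x = e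
      · rw [if_pos hex, card_pickSubset (hb e), if_neg]
        simp only [remainingColors, mem_filter]
        rintro ⟨-, -, hno⟩
        obtain ⟨C, hC, x, hx, hxe⟩ := hex
        exact hno C hC x hx hxe
      · rw [if_neg hex, card_empty]
        split_ifs with hrem
        · rfl
        -- A colour dropped without a circuit has budget zero.
        · by_contra hb0
          refine hrem (mem_filter.2 ⟨heJ, fun h => hb0 h.symm, fun C hC x hx hxe => ?_⟩)
          exact hex ⟨C, hC, x, hx, hxe⟩
    · rw [if_neg heJ] at hBe
      have hrem : e ∉ remainingColors 𝓕 κ b o s.1 J := fun h =>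
        heJ (remainingColors_subset 𝓕 κ b o s.1 J h)
      rw [if_neg, union_empty, hBe, if_neg hrem]
      rintro ⟨C, hC, x, hx, rfl⟩
      obtain ⟨i, -, hCU, -⟩ := color_of_mem_foundCircuits ho hC ⟨x, hx⟩
      exact heJ ((hU x).1 (hCU hx))

/-- Intersecting with `U` erases the settled colours, so `D` need only respect the budgets of the
other active ones. -/
theorem notMem_remainingColors (ho : ∀ S, o S = true ↔ ∀ e, #{x ∈ S | κ x = e} ≤ b e)
    {𝓕 : Finset (Finset E)} {J U D : Finset E} (hU : ∀ x, x ∈ U ↔ κ x ∈ J) (hD : D ∈ 𝓕) {i : E}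
    (hi : i ∈ J) (hDi : #{x ∈ D | κ x = i} = b i + 1)
    (hDj : ∀ j ∈ J, j ≠ i → #{x ∈ D | κ x = j} ≤ b j) :
    i ∉ remainingColors 𝓕 κ b o U J := by
  have hin : ∀ j ∈ J, {x ∈ D ∩ U | κ x = j} = {x ∈ D | κ x = j} := by
    intro j hj
    ext x
    simp only [mem_filter, mem_inter, hU]
    constructor
    · tauto
    · rintro ⟨h1, rfl⟩
      exact ⟨⟨h1, hj⟩, rfl⟩
  have hout : ∀ j, j ∉ J → {x ∈ D ∩ U | κ x = j} = ∅ := by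
    intro j hj
    refine filter_eq_empty_iff.2 fun x hx hxj => hj ?_
    rw [← hxj, ← hU]
    exact (mem_inter.1 hx).2
  have hdep : o (D ∩ U) = false := by
    by_contra hind
    rw [Bool.not_eq_false, ho] at hind
    have := hind i
    rw [hin i hi] at this
    omega
  obtain ⟨x, hx⟩ : {x ∈ D | κ x = i}.Nonempty := card_pos.1 (by omega)
  have hx' : x ∈ {x ∈ D ∩ U | κ x = i} := by rwa [hin i hi]
  have hind : o ((D ∩ U).erase x) = true := by
    refine (ho _).2 fun e => ?_
    rw [filter_erase]
    by_cases heJ : e ∈ J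
    · rw [hin e heJ]
      by_cases he : e = i
      · subst he
        rw [card_erase_of_mem hx]
        omega
      · exact (card_le_card (erase_subset _ _)).trans (hDj e heJ he)
    · simp [hout e heJ]
  intro hrem
  refine (mem_filter.1 hrem).2.2 ((D ∩ U).filter fun y => o ((D ∩ U).erase y)) ?_ x ?_
    (mem_filter.1 hx).2
  · exact mem_image.2 ⟨D ∩ U, mem_filter.2 ⟨mem_image_of_mem _ hD, hdep⟩, rfl⟩
  · exact mem_filter.2 ⟨(mem_filter.1 hx').1, hind⟩

theorem IsPartialState.card_union (hb : ∀ e, b e ≤ #{x | κ x = e}) {J : Finset E}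
    {s : Finset E × Finset E} (h : IsPartialState κ b J s)
    (hJ : ∀ e ∈ J, #{x | κ x = e} ≤ b e) (e : E) : #{x ∈ s.2 ∪ s.1 | κ x = e} = b e := by
  obtain ⟨hU, hB⟩ := h
  have hBe := hB e
  rw [filter_union]
  by_cases he : e ∈ J
  · rw [if_pos he, card_eq_zero] at hBe
    rw [hBe, empty_union]
    refine le_antisymm (le_trans (card_le_card (filter_subset_filter _ (subset_univ _)))
      (hJ e he)) ((hb e).trans (card_le_card fun x hx => ?_))
    have hxe := (mem_filter.1 hx).2
    exact mem_filter.2 ⟨(hU x).2 (hxe ▸ he), hxe⟩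
  · rw [if_neg he] at hBe
    rw [filter_eq_empty_iff (s := s.1).2 fun x hx hxe => he ?_, union_empty, hBe]
    rw [← hxe]
    exact (hU x).1 hx

end PartitionStep

/-! ### From matroids to colourings, and the final estimates. -/

section Main

open Finset

theorem Matroid.indepOracle_eq_true_iff {E : Type*} (M : Matroid E) (S : Finset E) :
    M.indepOracle S = true ↔ M.Indep (S : Set E) := by
  simp [Matroid.indepOracle]

theorem Matroid.IsPartitionMatroid.exists_coloring {E : Type*} [Fintype E] [DecidableEq E]
    {M : Matroid E} (h : M.IsPartitionMatroid) :
    ∃ (κ : E → E) (b : E → ℕ),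
      (∀ S, M.indepOracle S = true ↔ ∀ e, #{x ∈ S | κ x = e} ≤ b e) ∧
      ∀ e, b e ≤ #{x | κ x = e} := by
  obtain ⟨-, m, A, b, hdisj, hcover, hb, hind⟩ := h
  choose c hc using hcover
  have hcA : ∀ x i, x ∈ A i ↔ c x = i := by
    intro x i
    refine ⟨fun hx => ?_, fun hx => hx ▸ hc x⟩
    by_contra hne
    exact disjoint_left.1 (hdisj _ _ hne) (hc x) hx
  -- Each nonempty part is named by one of its elements; other elements name empty classes and get
  -- budget zero.
  let κ : E → E := fun x => @Function.invFun _ _ ⟨x⟩ c (c x)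
  have hcκ : ∀ x, c (κ x) = c x := fun x => @Function.invFun_eq _ _ ⟨x⟩ c (c x) ⟨x, rfl⟩
  have hκ : ∀ x y, κ x = κ y ↔ c x = c y := fun x y =>
    ⟨fun h => by rw [← hcκ x, h, hcκ], fun h => by simp only [κ, h]⟩
  have hclass : ∀ (S : Finset E) e, κ e = e → {x ∈ S | κ x = e} = S ∩ A (c e) := by
    intro S e he
    ext x
    rw [mem_filter, mem_inter, hcA, ← hκ, he]
  have hempty : ∀ (S : Finset E) e, κ e ≠ e → {x ∈ S | κ x = e} = ∅ := by
    intro S e he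
    refine filter_eq_empty_iff.2 fun x _ hx => he ?_
    subst hx
    rw [hκ, hcκ]
  refine ⟨κ, fun e => if κ e = e then b (c e) else 0, fun S => ?_, fun e => ?_⟩ <;>
    beta_reduce
  · rw [Matroid.indepOracle_eq_true_iff, hind]
    constructor
    · intro h e
      split_ifs with he
      · rw [hclass S e he]
        exact h _
      · simp [hempty S e he]
    · intro h i
      rcases (S ∩ A i).eq_empty_or_nonempty with h0 | ⟨x, hx⟩
      · simp [h0]
      · have hx' : c x = i := (hcA x i).1 (mem_inter.1 hx).2
        have he : κ (κ x) = κ x := by rw [hκ, hcκ]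
        have := h (κ x)
        rwa [if_pos he, hclass S _ he, hcκ, hx'] at this
  · split_ifs with he
    · rw [hclass univ e he, univ_inter]
      exact hb _
    · exact Nat.zero_le _

theorem Matroid.isBase_of_card_color_eq {E : Type*} [Fintype E] [DecidableEq E]
    {M : Matroid E} {κ : E → E} {b : E → ℕ}
    (ho : ∀ S, M.indepOracle S = true ↔ ∀ e, #{x ∈ S | κ x = e} ≤ b e) {B : Finset E}
    (hB : ∀ e, #{x ∈ B | κ x = e} = b e) : M.IsBase (B : Set E) := by
  have hind : ∀ S : Finset E, M.Indep (S : Set E) ↔ ∀ e, #{x ∈ S | κ x = e} ≤ b e := fun S => by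
    rw [← ho, Matroid.indepOracle_eq_true_iff]
  rw [Matroid.isBase_iff_maximal_indep]
  refine ⟨(hind B).2 fun e => (hB e).le, fun I hI hBI x hx => ?_⟩
  obtain ⟨I, rfl⟩ := (Set.toFinite I).exists_finset_coe
  have hsub : {y ∈ B | κ y = κ x} ⊆ {y ∈ I | κ y = κ x} :=
    filter_subset_filter _ (by exact_mod_cast hBI)
  have heq := eq_of_subset_of_card_le hsub (((hind I).1 hI (κ x)).trans (hB (κ x)).ge)
  have hxI : x ∈ {y ∈ I | κ y = κ x} := mem_filter.2 ⟨by exact_mod_cast hx, rfl⟩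
  rw [← heq] at hxI
  exact_mod_cast (mem_filter.1 hxI).1

theorem notMem_remainingColors_of_excessProb {n : ℕ} {κ : Fin n → Fin n}
    {b : Fin n → ℕ} {o : Finset (Fin n) → Bool}
    (ho : ∀ S, o S = true ↔ ∀ e, #{x ∈ S | κ x = e} ≤ b e) (hb : ∀ e, b e ≤ #{x | κ x = e})
    {𝓕 : Finset (Finset (Fin n))} {ε : ℝ}
    (h𝓕 : ∀ (κ : Fin n → Fin n) (b : Fin n → ℕ) (i : Fin n) (p : ℝ), (∀ e, b e ≤ n) →
        0 ≤ p → p ≤ 1 →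
        ε / 2 ≤ sampleProb p univ (fun S => b i < #{x ∈ S | κ x = i} ∧
          ∀ j, j ≠ i → #{x ∈ S | κ x = j} ≤ b j) →
        ∃ D ∈ 𝓕, #{x ∈ D | κ x = i} = b i + 1 ∧ ∀ j, j ≠ i → #{x ∈ D | κ x = j} ≤ b j)
    {J U : Finset (Fin n)} (hU : ∀ x, x ∈ U ↔ κ x ∈ J) {i : Fin n} (hi : i ∈ J) {p : ℝ}
    (hp : 0 ≤ p) (hp' : p ≤ 1) (hsum : ∑ j ∈ J, excessProb κ b j p ≤ 1 / 2)
    (hip : ε ≤ excessProb κ b i p) :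
    i ∉ remainingColors 𝓕 κ b o U J := by
  have hcard : ∀ e, #{x | κ x = e} ≤ n := fun e => by simpa using card_le_univ {x | κ x = e}
  -- Budget `n` makes inactive colours impossible to exceed, so the fixed family serves every active
  -- set `J`.
  let b' : Fin n → ℕ := fun e => if e ∈ J then b e else n
  have hb' : ∀ e ∈ J, b' e = b e := fun e he => if_pos he
  have hexc : ∀ e ∈ J, excessProb κ b' e p = excessProb κ b e p := fun e he => by
    simp only [excessProb, hb' e he]
  have hsum' : ∑ j, excessProb κ b' j p ≤ 1 / 2 := by
    rw [← sum_subset (subset_univ J), sum_congr rfl hexc]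
    · exact hsum
    · intro e _ he
      refine excessProb_eq_zero κ b' e p ?_
      simp only [b', if_neg he]
      exact hcard e
  have hiso := half_le_sampleProb_isolated κ b' i hp hp' hsum'
  have hip' : ε ≤ excessProb κ b' i p := by rwa [hexc i hi]
  obtain ⟨D, hD, hDi, hDj⟩ := h𝓕 κ b' i p
    (fun e => by
      simp only [b']
      split_ifs
      · exact (hb e).trans (hcard e)
      · exact le_rfl) hp hp'
    (le_trans (div_le_div_of_nonneg_right hip' zero_le_two) hiso)
  rw [hb' i hi] at hDi
  exact notMem_remainingColors ho hU hD hi hDi fun j hj hne => (hDj j hne).trans_eq (hb' j hj)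

/-- After sufficiently many steps the state contains a basis. -/
theorem card_color_iterate_partitionStep {n : ℕ} (hn : 0 < n) {κ : Fin n → Fin n}
    {b : Fin n → ℕ} {o : Finset (Fin n) → Bool}
    (ho : ∀ S, o S = true ↔ ∀ e, #{x ∈ S | κ x = e} ≤ b e) (hb : ∀ e, b e ≤ #{x | κ x = e})
    {𝓕 : Finset (Finset (Fin n))}
    (h𝓕 : ∀ (κ : Fin n → Fin n) (b : Fin n → ℕ) (i : Fin n) (p : ℝ), (∀ e, b e ≤ n) →
        0 ≤ p → p ≤ 1 →
        1 / (12 * (n : ℝ) ^ 2) / 2 ≤ sampleProb p univ (fun S => b i < #{x ∈ S | κ x = i} ∧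
          ∀ j, j ≠ i → #{x ∈ S | κ x = j} ≤ b j) →
        ∃ D ∈ 𝓕, #{x ∈ D | κ x = i} = b i + 1 ∧ ∀ j, j ≠ i → #{x ∈ D | κ x = j} ≤ b j)
    {s : ℝ} (hs : 0 < s) {R : ℕ}
    (hR : 5 * √(2 * s) + n / s + Real.logb 2 (13 * (n : ℝ) ^ 3) < R) (e : Fin n) :
    #{x ∈ ((fun s => partitionStep 𝓕 s o o)^[R] (univ, ∅)).2 ∪
      ((fun s => partitionStep 𝓕 s o o)^[R] (univ, ∅)).1 | κ x = e} = b e := by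
  set J : ℕ → Finset (Fin n) := fun r =>
    (fun J => remainingColors 𝓕 κ b o {x | κ x ∈ J} J)^[r] univ with hJ
  have hJs : ∀ r, J (r + 1) = remainingColors 𝓕 κ b o {x | κ x ∈ J r} (J r) := fun r =>
    Function.iterate_succ_apply' _ _ _
  have hstate : ∀ r, IsPartialState κ b (J r)
      ((fun s => partitionStep 𝓕 s o o)^[r] (univ, ∅)) := by
    intro r
    induction r with
    | zero => exact ⟨by simp [hJ], by simp [hJ]⟩
    | succ r ih =>
      rw [Function.iterate_succ_apply', hJs]
      have h1 : ((fun s => partitionStep 𝓕 s o o)^[r] (univ, ∅)).1 =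
          ({x | κ x ∈ J r} : Finset (Fin n)) := by
        ext x
        rw [ih.1 x]
        simp
      rw [← h1]
      exact ih.step ho hb 𝓕
  refine (hstate R).card_union hb ?_ e
  refine card_le_of_mem_of_steps hn κ b J (fun r => ?_) (fun r i hi p hp hp' hsum hip => ?_) hs hR
  · rw [hJs]
    exact remainingColors_subset _ _ _ _ _ _
  · rw [hJs]
    exact notMem_remainingColors_of_excessProb ho hb h𝓕 (by simp) hi hp hp' hsum hip

theorem exists_isolating_family_card_le {n : ℕ} (hn : 0 < n) :
    ∃ 𝓕 : Finset (Finset (Fin n)), #𝓕 ≤ 288 * n ^ 6 ∧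
      ∀ (κ : Fin n → Fin n) (b : Fin n → ℕ) (i : Fin n) (p : ℝ), (∀ e, b e ≤ n) →
        0 ≤ p → p ≤ 1 →
        1 / (12 * (n : ℝ) ^ 2) / 2 ≤ sampleProb p univ (fun S => b i < #{x ∈ S | κ x = i} ∧
          ∀ j, j ≠ i → #{x ∈ S | κ x = j} ≤ b j) →
        ∃ D ∈ 𝓕, #{x ∈ D | κ x = i} = b i + 1 ∧ ∀ j, j ≠ i → #{x ∈ D | κ x = j} ≤ b j := by
  have hn1 : (1 : ℝ) ≤ n := by exact_mod_cast hn
  -- Here `(n + 1) η = 1 / (24 n²)` is half the threshold `1 / (12 n²)`; the other half is lost in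
  -- isolating the colour.
  have hη : 1 / (24 * (n : ℝ) ^ 2 * (n + 1)) ≤ 1 := by
    rw [div_le_one (by positivity)]
    nlinarith [one_le_pow₀ hn1 (n := 2)]
  obtain ⟨𝓕, hcard, h𝓕⟩ := exists_isolating_family (n := n)
    (N := 24 * n ^ 2 * (n + 1) * ((2 * n + 1) * (n + 1))) hη (le_of_eq (by
      push_cast
      field_simp))
  refine ⟨𝓕, hcard.trans ?_, fun κ b i p hb hp hp' h => h𝓕 κ b i p hb hp hp' (le_trans ?_ h)⟩
  · calc 24 * n ^ 2 * (n + 1) * ((2 * n + 1) * (n + 1)) * n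
        ≤ 24 * n ^ 2 * (n + n) * ((2 * n + n) * (n + n)) * n := by gcongr <;> omega
      _ = 288 * n ^ 6 := by ring
  · refine le_of_eq ?_
    field_simp
    norm_num

/-- The value `s = n^(2/3)` balances `√s` against `n / s`. -/
theorem rounds_estimate {n : ℕ} (hn : 0 < n) :
    5 * √(2 * (n : ℝ) ^ (2 / 3 : ℝ)) + n / (n : ℝ) ^ (2 / 3 : ℝ) +
      Real.logb 2 (13 * (n : ℝ) ^ 3) ≤ 19 * ((n : ℝ) ^ (1 / 3 : ℝ) * Real.log ((n : ℝ) + 2)) := by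
  have hn1 : (1 : ℝ) ≤ n := by exact_mod_cast hn
  have hn0 : (0 : ℝ) < n := by linarith
  set t := (n : ℝ) ^ (1 / 3 : ℝ) with ht
  have ht1 : 1 ≤ t := Real.one_le_rpow hn1 (by norm_num)
  have hl : 1 ≤ Real.log ((n : ℝ) + 2) := by
    rw [Real.le_log_iff_exp_le (by linarith)]
    linarith [Real.exp_one_lt_d9]
  set l := Real.log ((n : ℝ) + 2) with hl'
  have h1 : (n : ℝ) ^ (2 / 3 : ℝ) = t ^ 2 := by
    rw [ht, ← Real.rpow_natCast, ← Real.rpow_mul hn0.le]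
    norm_num
  have h2 : (n : ℝ) = t ^ 3 := by
    rw [ht, ← Real.rpow_natCast, ← Real.rpow_mul hn0.le]
    norm_num
  have h3 : √(2 * t ^ 2) ≤ 3 / 2 * t := by
    rw [Real.sqrt_le_left (by positivity)]
    nlinarith
  have h4 : (n : ℝ) / t ^ 2 = t := by
    rw [h2]
    field_simp
  have h5 : Real.logb 2 (13 * (n : ℝ) ^ 3) ≤ 4 + 6 * l := by
    have h6 : Real.logb 2 (13 * (n : ℝ) ^ 3) ≤ Real.logb 2 (2 ^ 4 * (n : ℝ) ^ 3) :=
      Real.logb_le_logb_of_le one_lt_two (by positivity) (by gcongr; norm_num)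
    rw [Real.logb_mul (x := 2 ^ 4) (by positivity) (by positivity), Real.logb_pow 2 2,
      Real.logb_pow 2 (n : ℝ), Real.logb_self_eq_one one_lt_two] at h6
    have h7 : Real.logb 2 n ≤ 2 * l := by
      rw [Real.logb, div_le_iff₀ (Real.log_pos one_lt_two)]
      have h8 : Real.log n ≤ l := Real.log_le_log hn0 (by linarith)
      nlinarith [Real.log_two_gt_d9]
    push_cast at h6
    linarith
  rw [h1, h4]
  nlinarith [mul_nonneg (sub_nonneg.2 ht1) (sub_nonneg.2 hl)]

theorem exists_partitionBasisAlgorithm {n : ℕ} (hn : 0 < n) :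
    ∃ alg : QueryAlgorithm (Fin n), ∀ M : Matroid (Fin n), M.IsPartitionMatroid →
      M.IsBase (alg.result M.indepOracle : Set (Fin n)) ∧
      (alg.numRounds M.indepOracle : ℝ) ≤
        40 * ((n : ℝ) ^ (1 / 3 : ℝ) * Real.log ((n : ℝ) + 2)) ∧
      ∀ q ∈ alg.queryCounts M.indepOracle, q ≤ 600 * n ^ 8 := by
  obtain ⟨𝓕, hcard, h𝓕⟩ := exists_isolating_family_card_le hn
  have hn1 : (1 : ℝ) ≤ n := by exact_mod_cast hn
  set X := 5 * √(2 * (n : ℝ) ^ (2 / 3 : ℝ)) + n / (n : ℝ) ^ (2 / 3 : ℝ) +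
      Real.logb 2 (13 * (n : ℝ) ^ 3) with hX
  have hX0 : 0 ≤ X := by
    have : 0 ≤ Real.logb 2 (13 * (n : ℝ) ^ 3) :=
      Real.logb_nonneg one_lt_two (by linarith [one_le_pow₀ hn1 (n := 3)])
    positivity
  refine ⟨QueryAlgorithm.twoRoundLoop (fun s => traceQueries 𝓕 s.1)
    (fun s o => exchangeQueries (foundCircuits 𝓕 s.1 o)) (partitionStep 𝓕)
    (fun s => s.2 ∪ s.1) (⌊X⌋₊ + 1) (univ, ∅), fun M hM => ⟨?_, ?_, ?_⟩⟩
  · obtain ⟨κ, b, ho, hb⟩ := hM.exists_coloring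
    rw [QueryAlgorithm.twoRoundLoop_result (step := partitionStep 𝓕)
      fun _ _ _ h₁ h₂ => partitionStep_congr h₁ h₂]
    refine Matroid.isBase_of_card_color_eq ho fun e => ?_
    refine card_color_iterate_partitionStep hn ho hb h𝓕 (s := (n : ℝ) ^ (2 / 3 : ℝ))
      (by positivity) ?_ e
    push_cast
    exact Nat.lt_floor_add_one X
  · rw [QueryAlgorithm.twoRoundLoop_numRounds]
    push_cast
    have h1 := Nat.floor_le hX0
    have h2 := rounds_estimate hn
    have h3 : 1 ≤ (n : ℝ) ^ (1 / 3 : ℝ) := Real.one_le_rpow hn1 (by norm_num)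
    have h4 : 1 ≤ Real.log ((n : ℝ) + 2) := by
      rw [Real.le_log_iff_exp_le (by linarith)]
      linarith [Real.exp_one_lt_d9]
    linarith [one_le_mul_of_one_le_of_one_le h3 h4]
  · refine QueryAlgorithm.le_of_mem_twoRoundLoop_queryCounts (fun s => ?_) (fun s o => ?_) _ _ _
    · refine (card_traceQueries_le 𝓕 s.1).trans ?_
      rw [Fintype.card_fin]
      calc #𝓕 * (n + 1) ≤ 288 * n ^ 6 * (n + n) := by gcongr; omega
        _ = 576 * n ^ 7 := by ring
        _ ≤ 600 * n ^ 8 := Nat.mul_le_mul (by norm_num) (Nat.pow_le_pow_right hn (by norm_num))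
    · refine (card_exchangeQueries_le 𝓕 s.1 o).trans ?_
      rw [Fintype.card_fin]
      calc n + #𝓕 * (n * n) ≤ n ^ 8 + 288 * n ^ 6 * (n * n) := by
            gcongr
            exact Nat.le_self_pow (by norm_num) n
        _ = 289 * n ^ 8 := by ring
        _ ≤ 600 * n ^ 8 := Nat.mul_le_mul_right _ (by norm_num)

end Main

theorem theorem1p2 :
    ∃ (alg : ∀ n : ℕ, QueryAlgorithm (Fin n)) (C : ℝ) (c d : ℕ),
      ∀ (n : ℕ) (M : Matroid (Fin n)), M.IsPartitionMatroid →
        M.IsBase ((alg n).result M.indepOracle : Set (Fin n)) ∧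
        ((alg n).numRounds M.indepOracle : ℝ) ≤
          C * (n : ℝ) ^ (1 / 3 : ℝ) * Real.log ((n : ℝ) + 2) ^ c ∧
        (∀ q ∈ (alg n).queryCounts M.indepOracle, (q : ℝ) ≤ C * (n : ℝ) ^ d) ∧
        ((alg n).numQueries M.indepOracle : ℝ) ≤ C * (n : ℝ) ^ d := by
  choose A hA using fun n (hn : 0 < n) => exists_partitionBasisAlgorithm hn
  -- The total is at most `40 · n · 2n` rounds of `600 n⁸` queries, whence the exponent ten.
  refine ⟨fun n => if hn : 0 < n then A n hn else .output ∅, 50000, 1, 10, fun n M hM => ?_⟩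
  rcases Nat.eq_zero_or_pos n with rfl | hn
  · refine ⟨?_, ?_, ?_, ?_⟩
    · obtain ⟨B, hB⟩ := M.exists_isBase
      rw [Subsingleton.elim B ∅] at hB
      simpa [QueryAlgorithm.result] using hB
    all_goals simp [QueryAlgorithm.numRounds, QueryAlgorithm.numQueries,
      QueryAlgorithm.queryCounts]
  · obtain ⟨hbase, hrounds, hqueries⟩ := hA n hn M hM
    simp only [gt_iff_lt.1 hn, ↓reduceDIte]
    have hn1 : (1 : ℝ) ≤ n := by exact_mod_cast hn
    have ht1 : 0 ≤ (n : ℝ) ^ (1 / 3 : ℝ) := by positivity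
    have htn : (n : ℝ) ^ (1 / 3 : ℝ) ≤ n := by
      simpa using Real.rpow_le_rpow_of_exponent_le hn1 (by norm_num : (1 / 3 : ℝ) ≤ 1)
    have hl0 : 0 ≤ Real.log ((n : ℝ) + 2) := Real.log_nonneg (by linarith)
    have hln : Real.log ((n : ℝ) + 2) ≤ 2 * n := by
      linarith [Real.log_le_sub_one_of_pos (by linarith : (0 : ℝ) < n + 2)]
    refine ⟨hbase, ?_, fun q hq => ?_, ?_⟩
    · rw [pow_one, mul_assoc]
      linarith [mul_nonneg ht1 hl0]
    · have h1 : (q : ℝ) ≤ 600 * (n : ℝ) ^ 8 := by exact_mod_cast hqueries q hq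
      have h2 : (n : ℝ) ^ 8 ≤ (n : ℝ) ^ 10 := pow_le_pow_right₀ hn1 (by norm_num)
      linarith [pow_nonneg (zero_le_one.trans hn1) 8]
    · have h1 : ((A n hn).numQueries M.indepOracle : ℝ) ≤
          (A n hn).numRounds M.indepOracle * (600 * (n : ℝ) ^ 8) := by
        exact_mod_cast QueryAlgorithm.numQueries_le hqueries
      have h2 : (n : ℝ) ^ (1 / 3 : ℝ) * Real.log ((n : ℝ) + 2) ≤ n * (2 * n) := by gcongr
      calc ((A n hn).numQueries M.indepOracle : ℝ)
          ≤ (A n hn).numRounds M.indepOracle * (600 * (n : ℝ) ^ 8) := h1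
        _ ≤ 40 * (n * (2 * n)) * (600 * (n : ℝ) ^ 8) := by
            gcongr
            linarith
        _ = 48000 * (n : ℝ) ^ 10 := by ring
        _ ≤ 50000 * (n : ℝ) ^ 10 := by gcongr; norm_num
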